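/- **Conventions.** $\mathbb{R}^d$ carries the standard Gaussian measure $\gamma_d$; all functions $\mathbb{R}^d\to\{-1,1\}$ are Borel measurable. Such an $f$ is a *linear $1$-junta* if $f(x)=g(\langle u,x\rangle)$ for some unit vector $u$ and some $g:\mathbb{R}\to\{-1,1\}$; it is *$\varepsilon$-far from linear $1$-juntas* if $\gamma_d(f\ne h)\ge\varepsilon$ for every linear $1$-junta $h$. The *surface area* of $f$ is $\liminf_{\delta\to0^+}\gamma_d(A_\delta\setminus A)/\delta$, where $A=\{f=1\}$ and $A_\delta=\{x:d(x,A)\le\delta\}$, provided that the limit exists. A *non-adaptive tester with $q$ queries* draws a random seed, which determines query points $x_1,\dots,x_q\in\mathbb{R}^d$, and accepts or rejects according to the seed and to $f(x_1),\dots,f(x_q)$. It *distinguishes* two classes of functions if it accepts each function of the first class, and rejects each function of the second, with probability at least $2/3$. **The random functions.** Let $s\ge1$ be an integer. Let $\theta\in\mathbb{R}^2$ be a uniformly random unit vector and $\theta^\perp$ its clockwise rotation by $90^\circ$; let $a_1\le\dots\le a_{s-1}$ be $s-1$ uniform points of $[-1,1]$ in increasing order, $a_0=-1$, $a_s=1$;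 let $b_1,\dots,b_s$ be uniform in $\{-1,1\}$ and $z$ uniform in $[-1,1]$; all these choices are independent. If $a_{i-1}<\langle x,\theta\rangle\le a_i$ with $1\le i\le s$, put $f(x)=b_i$ and $g(x)=b_i\,\mathrm{sign}(\langle x,\theta^\perp\rangle-z)$, where $\mathrm{sign}(0)=1$; for all other $x$ put $f(x)=g(x)=1$. Let $D_1$ and $D_2$ be the laws of $f$ and of $g$. **Theorem.** 1. There is a constant $c>0$ such that for all $d\ge2$ and all real $s>0$, every non-adaptive tester on $\mathbb{R}^d$ that distinguishes the linear $1$-juntas of surface area at most $s$ from the functions that are $c$-far from linear $1$-juntas makes at least $s^{1/10}$ queries. 2. There is a constant $C>0$ such that for all integers $s\ge1$, all $n\le s^{1/10}$ and all $x_1,\dots,x_n\in\mathbb{R}^2$, if $f\sim D_1$ and $g\sim D_2$ then the laws of $(f(x_1),\dots,f(x_n))$ and $(g(x_1),\dots,g(x_n))$ are at total variation distance at most $C s^{-1/10}$. 3. There are constants $c,C,\alpha>0$ such that for all integers $s\ge1$, with probability at least $1-C s^{-\alpha}$ over $g\sim D_2$, the function $g$ is $c$-far from linear $1$-juntas. 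-/

import Mathlib

open MeasureTheory ProbabilityTheory Filter Topology
open scoped ENNReal RealInnerProductSpace

namespace JuntaLB

/-- The set `{-1, 1}` is modelled by `ℤˣ`; every subset of it is measurable. -/
instance instMeasurableSingletonClassSign : MeasurableSingletonClass ℤˣ where
  measurableSet_singleton b :=
    ⟨{(b : ℤ)}, measurableSet_singleton _, by ext c; simp [Units.ext_iff]⟩

/-! ### Linear juntas, distance, surface area -/

/-- `ℝ^d` with its Euclidean structure. -/
abbrev E (d : ℕ) : Type := EuclideanSpace ℝ (Fin d)

/-- The standard Gaussian probability measure on `ℝ^d`. -/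
noncomputable def gauss (d : ℕ) : Measure (E d) := stdGaussian (E d)

/-- `f` is a linear `k`-junta: it only depends on the inner products with `k` unit vectors. -/
def IsLinearJunta {d : ℕ} (k : ℕ) (f : E d → ℤˣ) : Prop :=
  ∃ (u : Fin k → E d) (g : (Fin k → ℝ) → ℤˣ),
    (∀ j, ‖u j‖ = 1) ∧ ∀ x, f x = g (fun j => ⟪u j, x⟫)

/-- `f` is `ε`-far from linear `k`-juntas: it disagrees with every measurable linear `k`-junta
with Gaussian probability at least `ε`. -/
def IsFarFromLinearJuntas {d : ℕ} (k : ℕ) (ε : ℝ) (f : E d → ℤˣ) : Prop :=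
  ∀ h : E d → ℤˣ, Measurable h → IsLinearJunta k h → ε ≤ (gauss d).real {x | f x ≠ h x}

/-- The quotient `vol(A_δ \ A) / δ`, where `vol` is the Gaussian measure and
`A_δ = {x | d(x, A) ≤ δ}` (so that `A_δ` is empty if `A` is). -/
noncomputable def shellRatio {d : ℕ} (A : Set (E d)) (δ : ℝ) : ℝ≥0∞ :=
  gauss d (Metric.cthickening δ A \ A) / ENNReal.ofReal δ

/-- The Gaussian surface area: the lower limit of the quotient as `δ` decreases to `0`. -/
noncomputable def surfaceArea {d : ℕ} (A : Set (E d)) : ℝ≥0∞ :=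
  liminf (shellRatio A) (𝓝[>] 0)

/-- `f` has a Gaussian surface area (the defining limit exists), and it is at most `s`.
The surface area of `f` is that of `{x | f x = 1}`. -/
def HasSurfaceAreaAtMost {d : ℕ} (f : E d → ℤˣ) (s : ℝ) : Prop :=
  Tendsto (shellRatio {x | f x = 1}) (𝓝[>] 0) (𝓝 (surfaceArea {x | f x = 1})) ∧
    surfaceArea {x | f x = 1} ≤ ENNReal.ofReal s

/-! ### Non-adaptive testers -/

/-- A (randomized) non-adaptive tester for functions `ℝ^d → {-1, 1}` making `q` queries: it draws a
random seed, the seed determines all the query points, and the tester accepts or rejects according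
to the seed and the answers. -/
structure NonadaptiveTester (d q : ℕ) where
  /-- the space of random seeds -/
  Seed : Type*
  [measurableSpaceSeed : MeasurableSpace Seed]
  /-- the law of the random seed -/
  law : Measure Seed
  [isProbabilityMeasure_law : IsProbabilityMeasure law]
  /-- the query points -/
  query : Seed → Fin q → E d
  measurable_query : Measurable query
  /-- the pairs (seed, answers) on which the tester accepts; it rejects on all others -/
  accept : Set (Seed × (Fin q → ℤˣ))
  measurableSet_accept : MeasurableSet accept

attribute [instance] NonadaptiveTester.measurableSpaceSeed
  NonadaptiveTester.isProbabilityMeasure_law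

/-- The probability that the tester accepts `f`. -/
noncomputable def NonadaptiveTester.acceptProb {d q : ℕ} (T : NonadaptiveTester d q)
    (f : E d → ℤˣ) : ℝ :=
  T.law.real {r | (r, fun i => f (T.query r i)) ∈ T.accept}

/-- The probability that the tester rejects `f`. -/
noncomputable def NonadaptiveTester.rejectProb {d q : ℕ} (T : NonadaptiveTester d q)
    (f : E d → ℤˣ) : ℝ :=
  T.law.real {r | (r, fun i => f (T.query r i)) ∉ T.accept}

/-- `T` distinguishes linear `1`-juntas of surface area at most `s` from functions that are
`ε`-far from linear `1`-juntas: it gives the right answer with probability at least `2/3`. -/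
def NonadaptiveTester.Distinguishes {d q : ℕ} (T : NonadaptiveTester d q) (s ε : ℝ) : Prop :=
  (∀ f : E d → ℤˣ, Measurable f → IsLinearJunta 1 f → HasSurfaceAreaAtMost f s →
      2 / 3 ≤ T.acceptProb f) ∧
    (∀ f : E d → ℤˣ, Measurable f → IsFarFromLinearJuntas 1 ε f → 2 / 3 ≤ T.rejectProb f)

/-! ### The random functions on `ℝ²` -/

/-- The randomness behind both random functions with `s` strips: an angle, `s - 1` cut positions
`a` (in no particular order), `s` signs `b`, and the height `z` of the orthogonal cut. -/
abbrev StripSeed (s : ℕ) : Type := ℝ × (Fin (s - 1) → ℝ) × (Fin s → ℤˣ) × ℝ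

/-- All components independent; the angle uniform on `[0, 2π)`, the cuts and the height uniform on
`[-1, 1]`, the signs uniform. -/
noncomputable def stripLaw (s : ℕ) : Measure (StripSeed s) :=
  (cond volume (Set.Ico 0 (2 * Real.pi))).prod
    ((Measure.pi fun _ => cond volume (Set.Icc (-1) 1)).prod
      ((uniformOn Set.univ).prod (cond volume (Set.Icc (-1) 1))))

instance instIsProbabilityMeasureStripLaw (s : ℕ) : IsProbabilityMeasure (stripLaw s) := by
  have h1 : IsProbabilityMeasure (cond (volume : Measure ℝ) (Set.Ico 0 (2 * Real.pi))) :=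
    cond_isProbabilityMeasure_of_finite (by simp [Real.pi_pos])
      (by rw [Real.volume_Ico]; exact ENNReal.ofReal_ne_top)
  have h2 : IsProbabilityMeasure (cond (volume : Measure ℝ) (Set.Icc (-1) 1)) :=
    cond_isProbabilityMeasure_of_finite (by simp) (by simp)
  have h3 : IsProbabilityMeasure (uniformOn (Set.univ : Set (Fin s → ℤˣ))) :=
    isProbabilityMeasure_uniformOn Set.finite_univ Set.univ_nonempty
  unfold stripLaw
  infer_instance

/-- The unit vector `θ` with the given angle. -/
noncomputable def direction (t : ℝ) : E 2 := !₂[Real.cos t, Real.sin t]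

/-- The clockwise rotation of `θ` by `90°`. -/
noncomputable def directionPerp (t : ℝ) : E 2 := !₂[Real.sin t, -Real.cos t]

/-- The (zero-based) number of the strip that contains `y`: the number of cuts that are `< y`. -/
noncomputable def stripIndex {m : ℕ} (a : Fin m → ℝ) (y : ℝ) : ℕ :=
  (Finset.univ.filter fun j => a j < y).card

/-- The index does not depend on the order in which the cuts are listed. -/
theorem stripIndex_comp_perm {m : ℕ} (a : Fin m → ℝ) (σ : Equiv.Perm (Fin m)) (y : ℝ) :
    stripIndex (a ∘ σ) y = stripIndex a y := by
  unfold stripIndex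
  exact Finset.card_equiv σ (by simp)

/-- If the cuts are listed in increasing order, then the index of `y` is `k` if and only if `y` is
above the first `k` cuts and not above the remaining ones, i.e. `a_k < y ≤ a_(k+1)` in one-based
numbering. -/
theorem stripIndex_eq_iff {m : ℕ} (a : Fin m → ℝ) (ha : Monotone a) (y : ℝ) (k : ℕ) (hk : k ≤ m) :
    stripIndex a y = k ↔ ∀ j : Fin m, (j : ℕ) < k ↔ a j < y := by
  unfold stripIndex
  constructor
  · intro h j
    constructor
    · intro hj
      by_contra hy
      have hsub : (Finset.univ.filter fun i => a i < y) ⊆ Finset.Iio j := by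
        intro i hi
        simp only [Finset.mem_filter, Finset.mem_univ, true_and] at hi
        rw [Finset.mem_Iio]
        by_contra hij
        exact hy ((ha (not_lt.mp hij)).trans_lt hi)
      have := Finset.card_le_card hsub
      rw [Fin.card_Iio] at this
      omega
    · intro hy
      have hsub : Finset.Iic j ⊆ (Finset.univ.filter fun i => a i < y) := by
        intro i hi
        rw [Finset.mem_Iic] at hi
        simpa using (ha hi).trans_lt hy
      have := Finset.card_le_card hsub
      rw [Fin.card_Iic] at this
      omega
  · intro h
    have : (Finset.univ.filter fun i => a i < y) = Finset.univ.filter fun i : Fin m => (i : ℕ) < k :=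
      Finset.filter_congr fun i _ => (h i).symm
    rw [this, Fin.card_filter_val_lt]
    omega

theorem stripIndex_le {m : ℕ} (a : Fin m → ℝ) (y : ℝ) : stripIndex a y ≤ m := by
  unfold stripIndex
  exact (Finset.card_le_univ _).trans (by simp)

/-- The sign attached to strip number `k`. (For `s ≥ 1` the strips are numbered `0, …, s - 1`, and
the second case does not occur.) -/
def stripSign {s : ℕ} (b : Fin s → ℤˣ) (k : ℕ) : ℤˣ :=
  if h : k < s then b ⟨k, h⟩ else 1

/-- The sign of a real number, with `sgn 0 = 1`. -/
noncomputable def sgn (y : ℝ) : ℤˣ := if 0 ≤ y then 1 else -1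

/-- The random function `f`: the sign `b_i` on the `i`-th strip, and `1` outside the strips. -/
noncomputable def stripFun {s : ℕ} (ω : StripSeed s) (x : E 2) : ℤˣ :=
  if -1 < ⟪x, direction ω.1⟫ ∧ ⟪x, direction ω.1⟫ ≤ 1 then
    stripSign ω.2.2.1 (stripIndex ω.2.1 ⟪x, direction ω.1⟫)
  else 1

/-- The random function `g`: as `f`, but each strip is cut at height `z` in the orthogonal
direction, with opposite signs on the two sides. -/
noncomputable def cutStripFun {s : ℕ} (ω : StripSeed s) (x : E 2) : ℤˣ :=
  if -1 < ⟪x, direction ω.1⟫ ∧ ⟪x, direction ω.1⟫ ≤ 1 then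
    stripSign ω.2.2.1 (stripIndex ω.2.1 ⟪x, direction ω.1⟫) *
      sgn (⟪x, directionPerp ω.1⟫ - ω.2.2.2)
  else 1

theorem measurable_direction : Measurable direction := by
  unfold direction
  fun_prop

theorem measurable_directionPerp : Measurable directionPerp := by
  unfold directionPerp
  fun_prop

theorem measurable_stripSign {α : Type*} [MeasurableSpace α] {s m : ℕ} {b : α → Fin s → ℤˣ}
    {a : α → Fin m → ℝ} {y : α → ℝ} (hb : Measurable b) (ha : Measurable a) (hy : Measurable y) :
    Measurable fun p => stripSign (b p) (stripIndex (a p) (y p)) := by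
  have hk : Measurable fun p => stripIndex (a p) (y p) := by
    unfold stripIndex
    simp only [Finset.card_filter]
    refine Finset.measurable_sum _ fun j _ => ?_
    exact Measurable.ite (measurableSet_lt ((measurable_pi_apply j).comp ha) hy)
      measurable_const measurable_const
  exact (Measurable.of_discrete (f := fun q : (Fin s → ℤˣ) × ℕ => stripSign q.1 q.2)).comp
    (hb.prodMk hk)

theorem measurable_sgn : Measurable sgn :=
  Measurable.ite measurableSet_Ici measurable_const measurable_const

/-- `f` is jointly measurable in the randomness and the point. -/
theorem measurable_stripFun (s : ℕ) :
    Measurable fun p : StripSeed s × E 2 => stripFun p.1 p.2 := by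
  have hy : Measurable fun p : StripSeed s × E 2 => ⟪p.2, direction p.1.1⟫ :=
    measurable_snd.inner (measurable_direction.comp (measurable_fst.comp measurable_fst))
  have hs := measurable_stripSign (s := s) (m := s - 1) (b := fun p : StripSeed s × E 2 => p.1.2.2.1)
    (a := fun p => p.1.2.1) (by fun_prop) (by fun_prop) hy
  exact Measurable.ite ((measurableSet_lt measurable_const hy).inter
    (measurableSet_le hy measurable_const)) hs measurable_const

/-- `g` is jointly measurable in the randomness and the point. -/
theorem measurable_cutStripFun (s : ℕ) :
    Measurable fun p : StripSeed s × E 2 => cutStripFun p.1 p.2 := by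
  have hy : Measurable fun p : StripSeed s × E 2 => ⟪p.2, direction p.1.1⟫ :=
    measurable_snd.inner (measurable_direction.comp (measurable_fst.comp measurable_fst))
  have hs := measurable_stripSign (s := s) (m := s - 1) (b := fun p : StripSeed s × E 2 => p.1.2.2.1)
    (a := fun p => p.1.2.1) (by fun_prop) (by fun_prop) hy
  have hz : Measurable fun p : StripSeed s × E 2 => ⟪p.2, directionPerp p.1.1⟫ - p.1.2.2.2 :=
    (measurable_snd.inner (measurable_directionPerp.comp
      (measurable_fst.comp measurable_fst))).sub (by fun_prop)
  have hm := (Measurable.of_discrete (f := fun q : ℤˣ × ℤˣ => q.1 * q.2)).comp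
    (hs.prodMk (measurable_sgn.comp hz))
  exact Measurable.ite ((measurableSet_lt measurable_const hy).inter
    (measurableSet_le hy measurable_const)) hm measurable_const

/-- The law of the answers `(f(x_1), …, f(x_n))`. -/
noncomputable def stripAnswers (s : ℕ) {n : ℕ} (x : Fin n → E 2) : Measure (Fin n → ℤˣ) :=
  (stripLaw s).map fun ω i => stripFun ω (x i)

/-- The law of the answers `(g(x_1), …, g(x_n))`. -/
noncomputable def cutStripAnswers (s : ℕ) {n : ℕ} (x : Fin n → E 2) : Measure (Fin n → ℤˣ) :=
  (stripLaw s).map fun ω i => cutStripFun ω (x i)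

/-- The total variation distance of two probability measures. -/
noncomputable def tvDist {X : Type*} [MeasurableSpace X] (μ ν : Measure X) : ℝ :=
  ⨆ A : {A : Set X // MeasurableSet A}, |μ.real A - ν.real A|

end JuntaLB

open JuntaLB

/-! Closeness. The seed consists of unsigned data (angle, cuts, height) and independent uniform
signs. If no strip contains queries on both sides of the orthogonal cut, then on the queries `g` is
`f` with the signs of some strips flipped (`exists_flip`), and a flip preserves the uniform law, so
the conditional laws of the answers agree. The remaining event is handled by a union bound over
pairs (`cutLaw_splitPair_le`): a pair closer than `s^(-3/10)` is rarely separated by the cut, and a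
more distant pair rarely shares a strip. The at most `s^(1/5)` ordered pairs cost `6 * s^(-1/10)` in
total.

Farness. A linear 1-junta is constant along some direction of any given plane. Resampling a Gaussian
vector twice along that direction gives two Gaussian points at which the junta agrees; whenever the
given function differs at them, it differs from the junta at one of them
(`isFarFromLinearJuntas_comp_planeProj`). It remains to bound the separated pairs on parallel lines
from below, for every direction. Lines nearly parallel to the strips cross the orthogonal cut
(`volume_cutSplit_vertical`). Lines nearly perpendicular to them pass from the strips of value `-1`
to the outer region of value `1` (`volume_cutSplit_horizontal`); here the strips of sign `-1` need
total width at least `1/2`, which a second moment bound provides (`prob_minusSet_lt_le`).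

Testers. `f` is a junta whose surface area is a sum of Gaussian densities at its jumps, hence at
most `s`. Averaging the tester over both random functions (`yao_strips`) shows that fewer than
`s^(1/10)` queries are possible only if there are at most 78 of them. So few queries are excluded
separately, for all `s`: the constant 1 must be distinguished from the functions that are `-1` on
one of 235 disjoint small discs (`card_discs_le`). -/

open JuntaLB

/-! ### Projecting and resampling standard Gaussian vectors -/

section Gaussian

variable {F : Type*} [NormedAddCommGroup F] [InnerProductSpace ℝ F] [FiniteDimensional ℝ F]
  [MeasurableSpace F] [BorelSpace F]

theorem map_inner_stdGaussian (v : F) (hv : ‖v‖ = 1) :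
    (stdGaussian F).map (fun x => ⟪v, x⟫) = gaussianReal 0 1 := by
  have hm : Measurable fun x : F => ⟪v, x⟫ := by fun_prop
  have := Measure.isProbabilityMeasure_map (μ := stdGaussian F) hm.aemeasurable
  refine Measure.ext_of_charFun ?_
  ext t
  rw [charFun_gaussianReal, charFun_apply, integral_map hm.aemeasurable (by fun_prop)]
  have h := charFun_stdGaussian (E := F) (t • v)
  rw [charFun_apply] at h
  have h2 : ∀ x : F, ⟪x, t • v⟫ = ⟪(⟪v, x⟫ : ℝ), t⟫ := by
    intro x
    rw [inner_smul_right, real_inner_comm x v]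
    simp
  simp_rw [h2] at h
  rw [h, norm_smul, hv]
  congr 1
  push_cast
  simp only [mul_one, ← Complex.ofReal_pow, Real.norm_eq_abs, sq_abs]
  push_cast
  simp
  ring

/-- Resampling the component of a standard Gaussian vector along a unit vector. -/
theorem map_resample_stdGaussian (v : F) (hv : ‖v‖ = 1) :
    ((stdGaussian F).prod (gaussianReal 0 1)).map
      (fun p => p.1 - ⟪v, p.1⟫ • v + p.2 • v) = stdGaussian F := by
  have hm : Measurable fun p : F × ℝ => p.1 - ⟪v, p.1⟫ • v + p.2 • v := by fun_prop
  have := Measure.isProbabilityMeasure_map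
    (μ := (stdGaussian F).prod (gaussianReal 0 1)) hm.aemeasurable
  refine Measure.ext_of_charFun ?_
  ext t
  rw [charFun_stdGaussian, charFun_apply, integral_map hm.aemeasurable (by fun_prop)]
  have h1 : ∀ p : F × ℝ, Complex.exp (((⟪p.1 - ⟪v, p.1⟫ • v + p.2 • v, t⟫ : ℝ) : ℂ) * Complex.I) =
      Complex.exp (((⟪p.1, t - ⟪v, t⟫ • v⟫ : ℝ) : ℂ) * Complex.I) *
        Complex.exp (((⟪p.2, (⟪v, t⟫ : ℝ)⟫ : ℝ) : ℂ) * Complex.I) := by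
    intro p
    rw [← Complex.exp_add, ← add_mul, ← Complex.ofReal_add]
    congr 3
    simp only [inner_add_left, inner_sub_left, inner_sub_right, inner_smul_left, inner_smul_right,
      RCLike.inner_apply, conj_trivial]
    rw [real_inner_comm v p.1]
    ring
  simp_rw [h1]
  rw [integral_prod_mul (μ := stdGaussian F) (ν := gaussianReal 0 1)
    (fun x : F => Complex.exp (((⟪x, t - ⟪v, t⟫ • v⟫ : ℝ) : ℂ) * Complex.I))
    (fun n : ℝ => Complex.exp (((⟪n, (⟪v, t⟫ : ℝ)⟫ : ℝ) : ℂ) * Complex.I)),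
    ← charFun_apply, ← charFun_apply, charFun_stdGaussian, charFun_gaussianReal,
    ← Complex.exp_add]
  congr 1
  have h3 : ‖t - ⟪v, t⟫ • v‖ ^ 2 = ‖t‖ ^ 2 - ⟪v, t⟫ ^ 2 := by
    rw [norm_sub_sq_real, inner_smul_right, norm_smul, hv, real_inner_comm v t, mul_one,
      Real.norm_eq_abs, sq_abs]
    ring
  rw [← Complex.ofReal_pow, h3]
  push_cast
  simp
  ring

end Gaussian

/-! ### Comparison of Gaussian and Lebesgue measure on a cube -/

theorem smul_restrict_le_gaussianReal (R : ℝ) :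
    gaussianPDF 0 1 R • volume.restrict (Set.Icc (-R) R) ≤ gaussianReal 0 1 := by
  rw [gaussianReal_of_var_ne_zero 0 one_ne_zero]
  intro S
  refine Measure.le_intro (fun S hS _ => ?_) S
  rw [withDensity_apply _ hS, Measure.smul_apply, Measure.restrict_apply hS, smul_eq_mul,
    ← setLIntegral_const]
  refine (setLIntegral_mono' (hS.inter measurableSet_Icc) fun x hx => ?_).trans
    (lintegral_mono_set Set.inter_subset_left)
  unfold gaussianPDF gaussianPDFReal
  refine ENNReal.ofReal_le_ofReal ?_
  gcongr 2
  have := abs_le.2 hx.2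
  have h2 := sq_le_sq' (abs_le.1 this).1 (abs_le.1 this).2
  simp only [sub_zero]
  gcongr

/-- The standard Gaussian measure on `ℝ³`, as a product. -/
noncomputable def gaussTriple : Measure (ℝ × ℝ × ℝ) :=
  (gaussianReal 0 1).prod ((gaussianReal 0 1).prod (gaussianReal 0 1))

instance : IsProbabilityMeasure gaussTriple := by
  unfold gaussTriple; infer_instance

/-- The cube `[-R, R]³`. -/
def cube (R : ℝ) : Set (ℝ × ℝ × ℝ) :=
  Set.Icc (-R) R ×ˢ Set.Icc (-R) R ×ˢ Set.Icc (-R) R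

theorem measurableSet_cube (R : ℝ) : MeasurableSet (cube R) :=
  measurableSet_Icc.prod (measurableSet_Icc.prod measurableSet_Icc)

/-- On the cube the density is smallest at the corners. Geometric lower bounds can therefore be
proved for Lebesgue measure, which is invariant under translations. -/
theorem le_gaussTriple (R : ℝ) (S : Set (ℝ × ℝ × ℝ)) :
    gaussianPDF 0 1 R ^ 3 * volume (S ∩ cube R) ≤ gaussTriple S := by
  have h := smul_restrict_le_gaussianReal R
  have h3 := Measure.prod_mono h (Measure.prod_mono h h)
  have := h3 S
  refine le_trans (le_of_eq ?_) this
  have hfin : IsFiniteMeasure (gaussianPDF 0 1 R • volume.restrict (Set.Icc (-R) R)) :=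
    isFiniteMeasure_of_le _ h
  have e : (gaussianPDF 0 1 R • volume.restrict (Set.Icc (-R) R)).prod
      ((gaussianPDF 0 1 R • volume.restrict (Set.Icc (-R) R)).prod
        (gaussianPDF 0 1 R • volume.restrict (Set.Icc (-R) R))) =
      gaussianPDF 0 1 R ^ 3 • volume.restrict (cube R) := by
    simp only [Measure.prod_smul_left, Measure.prod_smul_right, Measure.prod_restrict, smul_smul]
    rw [pow_succ, pow_two, mul_assoc]
    rfl
  rw [e, Measure.smul_apply, Measure.restrict_apply' (measurableSet_cube R), smul_eq_mul]

/-! ### A criterion for being far from linear juntas -/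

theorem exists_eq_norm_smul_direction (p : E 2) : ∃ t : ℝ, p = ‖p‖ • direction t := by
  have hn : ‖p‖ = ‖(⟨p 0, p 1⟩ : ℂ)‖ := by
    rw [EuclideanSpace.norm_eq, Complex.norm_def, Complex.normSq_mk]
    simp [Fin.sum_univ_two, pow_two]
  refine ⟨Complex.arg ⟨p 0, p 1⟩, ?_⟩
  rw [hn]
  ext i
  fin_cases i
  · simp [direction]
  · simp [direction]

theorem inner_E_two (x y : E 2) : ⟪x, y⟫ = x 0 * y 0 + x 1 * y 1 := by
  simp [PiLp.inner_apply, Fin.sum_univ_two, mul_comm]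

@[simp] theorem direction_apply_zero (t : ℝ) : direction t 0 = Real.cos t := rfl
@[simp] theorem direction_apply_one (t : ℝ) : direction t 1 = Real.sin t := rfl
@[simp] theorem directionPerp_apply_zero (t : ℝ) : directionPerp t 0 = Real.sin t := rfl
@[simp] theorem directionPerp_apply_one (t : ℝ) : directionPerp t 1 = -Real.cos t := rfl

theorem norm_direction (t : ℝ) : ‖direction t‖ = 1 := by
  rw [EuclideanSpace.norm_eq]
  simp [Fin.sum_univ_two]

theorem norm_directionPerp (t : ℝ) : ‖directionPerp t‖ = 1 := by
  rw [EuclideanSpace.norm_eq]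
  simp [Fin.sum_univ_two]

theorem inner_direction_direction (t t' : ℝ) :
    ⟪direction t, direction t'⟫ = Real.cos (t - t') := by
  rw [inner_E_two, Real.cos_sub]; simp

theorem inner_directionPerp_direction (t t' : ℝ) :
    ⟪directionPerp t, direction t'⟫ = Real.sin (t - t') := by
  rw [inner_E_two, Real.sin_sub]; simp; ring

theorem inner_direction_directionPerp (t t' : ℝ) :
    ⟪direction t, directionPerp t'⟫ = -Real.sin (t - t') := by
  rw [inner_E_two, Real.sin_sub]; simp; ring

theorem inner_directionPerp_directionPerp (t t' : ℝ) :
    ⟪directionPerp t, directionPerp t'⟫ = Real.cos (t - t') := by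
  rw [inner_E_two, Real.cos_sub]; simp; ring

theorem exists_inner_direction_eq_zero (p : E 2) : ∃ t : ℝ, ⟪direction t, p⟫ = 0 := by
  obtain ⟨t, ht⟩ := exists_eq_norm_smul_direction p
  refine ⟨t + Real.pi / 2, ?_⟩
  rw [ht, inner_smul_right, inner_direction_direction]
  simp

theorem eq_inner_smul_add (t : ℝ) (y : E 2) :
    y = ⟪directionPerp t, y⟫ • directionPerp t + ⟪direction t, y⟫ • direction t := by
  have h := Real.sin_sq_add_cos_sq t
  ext i
  fin_cases i
  · simp [inner_E_two]
    linear_combination (-y 0) * h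
  · simp [inner_E_two]
    linear_combination (-y 1) * h

/-- The pairs of points on a common line in direction `direction t` (both given by their coordinates
in the orthonormal basis `directionPerp t, direction t`) on which `f` differs. -/
def splitSet (f : E 2 → ℤˣ) (t : ℝ) : Set (ℝ × ℝ × ℝ) :=
  {p | f (p.1 • directionPerp t + p.2.1 • direction t) ≠
    f (p.1 • directionPerp t + p.2.2 • direction t)}

theorem measurableSet_splitSet {f : E 2 → ℤˣ} (hf : Measurable f) (t : ℝ) :
    MeasurableSet (splitSet f t) :=
  (measurableSet_eq_fun (by fun_prop) (by fun_prop)).compl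

/-- The projection to the plane embedded by `ι`. -/
noncomputable def planeProj {d : ℕ} (ι : E 2 →ₗᵢ[ℝ] E d) : E d →L[ℝ] E 2 :=
  ContinuousLinearMap.adjoint ι.toContinuousLinearMap

theorem inner_planeProj {d : ℕ} (ι : E 2 →ₗᵢ[ℝ] E d) (x : E d) (y : E 2) :
    ⟪planeProj ι x, y⟫ = ⟪x, ι y⟫ := by
  unfold planeProj
  rw [ContinuousLinearMap.adjoint_inner_left]
  rfl

theorem planeProj_apply_self {d : ℕ} (ι : E 2 →ₗᵢ[ℝ] E d) (y : E 2) : planeProj ι (ι y) = y := by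
  refine ext_inner_right ℝ fun w => ?_
  rw [inner_planeProj, ι.inner_map_map]

theorem planeProj_id (x : E 2) : planeProj LinearIsometry.id x = x := by
  refine ext_inner_right ℝ fun w => ?_
  rw [inner_planeProj]; rfl

/-- Two resamplings along a direction on which the junta `h` is constant have equal `h`-values, so a
pair on which `f` differs contains a point of disagreement with `h`. Both points are Gaussian,
whence the factor `2`. -/
theorem isFarFromLinearJuntas_comp_planeProj {d : ℕ} (ι : E 2 →ₗᵢ[ℝ] E d) {f : E 2 → ℤˣ}
    (hf : Measurable f) {c : ℝ} (hc : ∀ t, 2 * c ≤ gaussTriple.real (splitSet f t)) :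
    IsFarFromLinearJuntas 1 c fun x => f (planeProj ι x) := by
  rintro h hh ⟨u, g, -, hg⟩
  -- The plane is two-dimensional, so it contains a direction orthogonal to `u 0`, even if the
  -- projection of `u 0` vanishes.
  obtain ⟨t, ht⟩ := exists_inner_direction_eq_zero (planeProj ι (u 0))
  set v := ι (direction t) with hv
  set w := ι (directionPerp t) with hw
  have hvn : ‖v‖ = 1 := by rw [hv, ι.norm_map, norm_direction]
  have hwn : ‖w‖ = 1 := by rw [hw, ι.norm_map, norm_directionPerp]
  have huv : ⟪u 0, v⟫ = 0 := by rw [hv, ← inner_planeProj, real_inner_comm, ht]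
  set T : E d × ℝ → E d := fun p => p.1 - ⟪v, p.1⟫ • v + p.2 • v with hT
  have hTm : Measurable T := by fun_prop
  set D : Set (E d) := {x | f (planeProj ι x) ≠ h x} with hD
  have hDm : MeasurableSet D := by
    refine (measurableSet_eq_fun ?_ hh).compl
    exact hf.comp (planeProj ι).measurable
  have hhT : ∀ x n n', h (T (x, n)) = h (T (x, n')) := by
    intro x n n'
    rw [hg, hg]
    congr 1
    ext j
    rw [Subsingleton.elim j 0]
    simp only [hT, inner_add_right, inner_sub_right, inner_smul_right, huv]
    ring
  have hfT : ∀ x n, planeProj ι (T (x, n)) = ⟪w, x⟫ • directionPerp t + n • direction t := by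
    intro x n
    have e := eq_inner_smul_add t (planeProj ι x)
    rw [real_inner_comm, inner_planeProj, real_inner_comm _ (direction t), inner_planeProj,
      ← hv, ← hw, real_inner_comm w, real_inner_comm v] at e
    simp only [hT, map_add, map_sub, map_smul]
    rw [hv, planeProj_apply_self, ← hv]
    nth_rewrite 1 [e]
    abel
  have hres : MeasurePreserving T ((gauss d).prod (gaussianReal 0 1)) (gauss d) :=
    ⟨hTm, map_resample_stdGaussian v hvn⟩
  set M : Measure (E d × ℝ × ℝ) :=
    (gauss d).prod ((gaussianReal 0 1).prod (gaussianReal 0 1)) with hM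
  have hgp : IsProbabilityMeasure (gauss d) := by unfold gauss; infer_instance
  -- The two points share `x` and use independent new components; only their marginal laws matter
  -- for the union bound.
  have h1 : MeasurePreserving (fun p : E d × ℝ × ℝ => T (p.1, p.2.1)) M (gauss d) :=
    hres.comp ((MeasurePreserving.id _).prod measurePreserving_fst)
  have h2 : MeasurePreserving (fun p : E d × ℝ × ℝ => T (p.1, p.2.2)) M (gauss d) :=
    hres.comp ((MeasurePreserving.id _).prod measurePreserving_snd)
  have h3 : MeasurePreserving (fun p : E d × ℝ × ℝ => (⟪w, p.1⟫, p.2)) M gaussTriple :=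
    MeasurePreserving.prod ⟨by fun_prop, map_inner_stdGaussian w hwn⟩ (MeasurePreserving.id _)
  have hsub : (fun p : E d × ℝ × ℝ => ((⟪w, p.1⟫ : ℝ), p.2)) ⁻¹' splitSet f t ⊆
      (fun p : E d × ℝ × ℝ => T (p.1, p.2.1)) ⁻¹' D ∪
        (fun p : E d × ℝ × ℝ => T (p.1, p.2.2)) ⁻¹' D := by
    rintro ⟨x, n, n'⟩ hx
    by_contra hcon
    simp only [Set.mem_union, Set.mem_preimage, hD, Set.mem_ofPred_eq, not_or, not_not, hfT] at hcon
    apply hx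
    simp only
    rw [hcon.1, hcon.2, hhT x n n']
  have key : gaussTriple.real (splitSet f t) ≤ (gauss d).real D + (gauss d).real D := by
    rw [← h3.measureReal_preimage (measurableSet_splitSet hf t).nullMeasurableSet]
    refine (measureReal_mono hsub).trans ((measureReal_union_le _ _).trans (le_of_eq ?_))
    rw [h1.measureReal_preimage hDm.nullMeasurableSet, h2.measureReal_preimage hDm.nullMeasurableSet]
  linarith [hc t]

/-! ### The random strips -/

/-- The uniform law on `[-1, 1]`. -/
noncomputable abbrev unifLaw : Measure ℝ := cond volume (Set.Icc (-1) 1)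

instance isProbabilityMeasure_unifLaw : IsProbabilityMeasure unifLaw :=
  cond_isProbabilityMeasure_of_finite (by simp) (by simp)

/-- The uniform law on the angles in `[0, 2π)`. -/
noncomputable abbrev angleLaw : Measure ℝ := cond volume (Set.Ico 0 (2 * Real.pi))

instance isProbabilityMeasure_angleLaw : IsProbabilityMeasure angleLaw :=
  cond_isProbabilityMeasure_of_finite (by simp [Real.pi_pos])
    (by rw [Real.volume_Ico]; exact ENNReal.ofReal_ne_top)

instance isProbabilityMeasure_uniformSigns (s : ℕ) :
    IsProbabilityMeasure (uniformOn (Set.univ : Set (Fin s → ℤˣ))) :=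
  isProbabilityMeasure_uniformOn Set.finite_univ Set.univ_nonempty

theorem measurePreserving_mul_uniformSigns {s : ℕ} (σ : Fin s → ℤˣ) :
    MeasurePreserving (fun b : Fin s → ℤˣ => b * σ) (uniformOn Set.univ) (uniformOn Set.univ) := by
  refine ⟨by fun_prop, ?_⟩
  ext S hS
  rw [Measure.map_apply (by fun_prop) hS, uniformOn_univ, uniformOn_univ]
  congr 1
  rw [Measure.count_apply (hS.preimage (by fun_prop)), Measure.count_apply hS]
  rw [Set.encard_preimage_of_bijective (Group.mulRight_bijective σ) S]

/-- Flipping the `k`-th sign alone preserves the law and negates the integrand. -/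
theorem integral_mul_uniformSigns {s : ℕ} {k l : Fin s} (hkl : k ≠ l) :
    ∫ b : Fin s → ℤˣ, (((b k : ℤ) : ℝ) * ((b l : ℤ) : ℝ)) ∂(uniformOn Set.univ) = 0 := by
  set σ : Fin s → ℤˣ := Pi.mulSingle k (-1) with hσ
  have h := (measurePreserving_mul_uniformSigns σ).integral_comp'
    (f := MeasurableEquiv.mulRight σ)
    (fun b : Fin s → ℤˣ => (((b k : ℤ) : ℝ) * ((b l : ℤ) : ℝ)))
  have h2 : ∀ b : Fin s → ℤˣ, ((((b * σ) k : ℤˣ) : ℤ) : ℝ) * ((((b * σ) l : ℤˣ) : ℤ) : ℝ) =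
        -(((b k : ℤ) : ℝ) * ((b l : ℤ) : ℝ)) := by
    intro b
    simp [hσ, Pi.mulSingle_eq_of_ne' hkl]
  simp only [MeasurableEquiv.coe_mulRight, h2, integral_neg] at h
  linarith

theorem unifLaw_apply (S : Set ℝ) : unifLaw S = volume (Set.Icc (-1) 1 ∩ S) / 2 := by
  rw [cond_apply measurableSet_Icc, Real.volume_Icc, ENNReal.div_eq_inv_mul]
  norm_num

theorem unifLaw_compl_Ico_le {x y : ℝ} (hx : -1 ≤ x) (hxy : x ≤ y) (hy : y ≤ 1) :
    unifLaw (Set.Ico x y)ᶜ ≤ ENNReal.ofReal (1 - (y - x) / 2) := by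
  have h : unifLaw (Set.Ico x y) = ENNReal.ofReal ((y - x) / 2) := by
    rw [unifLaw_apply, Set.inter_eq_self_of_subset_right, Real.volume_Ico,
      ENNReal.ofReal_div_of_pos two_pos]
    · norm_num
    · exact fun u hu => ⟨hx.trans hu.1, hu.2.le.trans hy⟩
  rw [prob_compl_eq_one_sub measurableSet_Ico, h, ← ENNReal.ofReal_one,
    ENNReal.ofReal_sub _ (by linarith)]

theorem measurable_stripIndex {α : Type*} [MeasurableSpace α] {m : ℕ} {a : α → Fin m → ℝ}
    {y : α → ℝ} (ha : Measurable a) (hy : Measurable y) :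
    Measurable fun p => stripIndex (a p) (y p) := by
  unfold stripIndex
  simp only [Finset.card_filter]
  exact Finset.measurable_sum _ fun j _ => Measurable.ite
    (measurableSet_lt ((measurable_pi_apply j).comp ha) hy) measurable_const measurable_const

/-- Two points of `[-1, 1]` lie in the same strip with exponentially small probability. -/
theorem sameStrip_le (m : ℕ) {x y : ℝ} (hx : x ∈ Set.Icc (-1 : ℝ) 1)
    (hy : y ∈ Set.Icc (-1 : ℝ) 1) :
    Measure.pi (fun _ : Fin m => unifLaw) {a | stripIndex a x = stripIndex a y} ≤
      ENNReal.ofReal (Real.exp (-(m * |x - y| / 2))) := by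
  wlog hxy : x ≤ y generalizing x y
  · have := this hy hx (le_of_not_ge hxy)
    rw [abs_sub_comm]
    convert this using 4
    exact eq_comm
  have hsub : {a : Fin m → ℝ | stripIndex a x = stripIndex a y} ⊆
      Set.pi Set.univ fun _ => (Set.Ico x y)ᶜ := by
    intro a ha j _ hj
    have hlt : stripIndex a x < stripIndex a y := by
      unfold stripIndex
      refine Finset.card_lt_card ⟨?_, ?_⟩
      · intro i hi
        simp only [Finset.mem_filter, Finset.mem_univ, true_and] at hi ⊢
        exact hi.trans_le hxy
      · intro hcon
        have := hcon (by simpa using hj.2 : j ∈ Finset.univ.filter fun j => a j < y)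
        simp only [Finset.mem_filter, Finset.mem_univ, true_and] at this
        exact absurd this (not_lt.2 hj.1)
    exact hlt.ne ha
  refine (measure_mono hsub).trans ?_
  rw [Measure.pi_pi, Finset.prod_const, Finset.card_univ, Fintype.card_fin]
  refine (pow_le_pow_left' (unifLaw_compl_Ico_le hx.1 hxy hy.2) m).trans ?_
  have h0 : 0 ≤ 1 - (y - x) / 2 := by linarith [hx.1, hy.2]
  rw [← ENNReal.ofReal_pow h0]
  refine ENNReal.ofReal_le_ofReal ?_
  have h1 : 1 - (y - x) / 2 ≤ Real.exp (-((y - x) / 2)) := Real.one_sub_le_exp_neg _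
  refine (pow_le_pow_left₀ h0 h1 m).trans (le_of_eq ?_)
  rw [← Real.exp_nat_mul, abs_sub_comm, abs_of_nonneg (sub_nonneg.2 hxy)]
  congr 1
  ring

theorem exp_neg_le_inv {u : ℝ} (hu : 0 < u) : Real.exp (-u) ≤ u⁻¹ := by
  rw [Real.exp_neg]
  exact inv_anti₀ hu (by linarith [Real.add_one_le_exp u])

theorem unit_mul_integral (u : ℤˣ) : ((u : ℤ) : ℝ) * ((u : ℤ) : ℝ) = 1 := by
  rcases Int.units_eq_one_or u with rfl | rfl <;> simp

/-- The value of a strip function at height `y`. -/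
noncomputable def stripVal {s : ℕ} (a : Fin (s - 1) → ℝ) (b : Fin s → ℤˣ) (y : ℝ) : ℤˣ :=
  stripSign b (stripIndex a y)

theorem measurable_stripVal (s : ℕ) :
    Measurable fun p : (Fin (s - 1) → ℝ) × (Fin s → ℤˣ) × ℝ => stripVal p.1 p.2.1 p.2.2 :=
  measurable_stripSign (by fun_prop) (by fun_prop) (by fun_prop)

theorem stripVal_eq {s : ℕ} (hs : 1 ≤ s) (a : Fin (s - 1) → ℝ) (b : Fin s → ℤˣ) (y : ℝ) :
    stripVal a b y = b ⟨stripIndex a y, by have := stripIndex_le a y; omega⟩ := by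
  have := stripIndex_le a y
  rw [stripVal, stripSign, dif_pos (by omega)]

theorem integral_stripVal_mul {s : ℕ} (hs : 1 ≤ s) (a : Fin (s - 1) → ℝ) (x y : ℝ) :
    ∫ b : Fin s → ℤˣ, (((stripVal a b x : ℤ) : ℝ) * ((stripVal a b y : ℤ) : ℝ))
        ∂(uniformOn Set.univ) =
      Set.indicator {p : ℝ × ℝ | stripIndex a p.1 = stripIndex a p.2} 1 (x, y) := by
  simp only [stripVal_eq hs]
  by_cases h : stripIndex a x = stripIndex a y
  · rw [Set.indicator_of_mem (by exact h)]
    simp [h, unit_mul_integral]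
  · rw [Set.indicator_of_notMem (by exact h)]
    exact integral_mul_uniformSigns (by simpa using h)

/-- The part of `(-1, 1]` on which the strip function is `-1`. -/
def minusSet {s : ℕ} (a : Fin (s - 1) → ℝ) (b : Fin s → ℤˣ) : Set ℝ :=
  {x | x ∈ Set.Ioc (-1) 1 ∧ stripVal a b x = -1}

theorem measurable_stripVal_right {s : ℕ} (a : Fin (s - 1) → ℝ) (b : Fin s → ℤˣ) :
    Measurable (stripVal a b) :=
  (measurable_stripVal s).comp (by fun_prop : Measurable fun x : ℝ => (a, b, x))

theorem measurableSet_minusSet {s : ℕ} (a : Fin (s - 1) → ℝ) (b : Fin s → ℤˣ) :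
    MeasurableSet (minusSet a b) :=
  measurableSet_Ioc.inter (measurableSet_eq_fun (measurable_stripVal_right a b) measurable_const)

/-- Lebesgue measure on `(-1, 1]`. -/
noncomputable abbrev segLaw : Measure ℝ := volume.restrict (Set.Ioc (-1) 1)

theorem integral_stripVal {s : ℕ} (a : Fin (s - 1) → ℝ) (b : Fin s → ℤˣ) :
    ∫ x, ((stripVal a b x : ℤ) : ℝ) ∂segLaw = 2 - 2 * volume.real (minusSet a b) := by
  have h : ∀ x ∈ Set.Ioc (-1 : ℝ) 1, ((stripVal a b x : ℤ) : ℝ) =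
      1 - 2 * (minusSet a b).indicator 1 x := by
    intro x hx
    by_cases hx2 : stripVal a b x = -1
    · rw [Set.indicator_of_mem (by exact ⟨hx, hx2⟩), hx2]
      norm_num
    · rw [Set.indicator_of_notMem (fun h => hx2 h.2)]
      rcases Int.units_eq_one_or (stripVal a b x) with h1 | h1
      · simp [h1]
      · exact absurd h1 hx2
  have hi : Integrable ((minusSet a b).indicator (1 : ℝ → ℝ)) segLaw :=
    (integrable_const (1 : ℝ)).indicator (measurableSet_minusSet a b)
  rw [setIntegral_congr_fun measurableSet_Ioc h, integral_sub (integrable_const _) (hi.const_mul 2),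
    integral_const_mul, integral_indicator_one (measurableSet_minusSet a b), integral_const,
    measureReal_restrict_apply (measurableSet_minusSet a b),
    Set.inter_eq_self_of_subset_left (fun x hx => hx.1)]
  simp
  norm_num

/-- Second moment method: strip signs are uncorrelated, so the square of the integral of the strip
function has mean equal to the area of the pairs in a common strip. A small minus set forces this
square above `1`, and Markov's inequality applies. -/
theorem prob_minusSet_lt_le {s : ℕ} (hs : 1 ≤ s) (a : Fin (s - 1) → ℝ) :
    uniformOn Set.univ {b : Fin s → ℤˣ | volume.real (minusSet a b) < 1 / 2} ≤
      (segLaw.prod segLaw) {p : ℝ × ℝ | stripIndex a p.1 = stripIndex a p.2} := by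
  set S := {p : ℝ × ℝ | stripIndex a p.1 = stripIndex a p.2} with hS
  have hidx : Measurable fun y : ℝ => stripIndex a y :=
    measurable_stripIndex measurable_const measurable_id
  have hSm : MeasurableSet S := measurableSet_eq_fun (by fun_prop) (by fun_prop)
  set G : (Fin s → ℤˣ) → ℝ := fun b => (∫ x, ((stripVal a b x : ℤ) : ℝ) ∂segLaw) ^ 2 with hG
  have hGint : ∫ b, G b ∂(uniformOn Set.univ) = (segLaw.prod segLaw).real S := by
    have h1 : ∀ b, G b = ∫ p : ℝ × ℝ, (((stripVal a b p.1 : ℤ) : ℝ) *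
        ((stripVal a b p.2 : ℤ) : ℝ)) ∂(segLaw.prod segLaw) := by
      intro b
      have := integral_prod_mul (μ := segLaw) (ν := segLaw)
        (fun x => ((stripVal a b x : ℤ) : ℝ)) (fun x => ((stripVal a b x : ℤ) : ℝ))
      rw [this, hG]
      ring
    simp_rw [h1]
    rw [integral_integral_swap]
    · simp_rw [integral_stripVal_mul hs]
      rw [← integral_indicator_one hSm]
    · refine Integrable.of_bound (C := 1) ?_ (ae_of_all _ ?_)
      · have e : Measurable fun q : (Fin s → ℤˣ) × ℝ × ℝ => (stripVal a q.1 q.2.1, stripVal a q.1 q.2.2) := by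
          refine Measurable.prodMk ?_ ?_
          · exact (measurable_stripVal s).comp
              (by fun_prop : Measurable fun q : (Fin s → ℤˣ) × ℝ × ℝ => (a, q.1, q.2.1))
          · exact (measurable_stripVal s).comp
              (by fun_prop : Measurable fun q : (Fin s → ℤˣ) × ℝ × ℝ => (a, q.1, q.2.2))
        exact ((Measurable.of_discrete (f := fun q : ℤˣ × ℤˣ => ((q.1 : ℤ) : ℝ) * ((q.2 : ℤ) : ℝ))).comp
          e).aestronglyMeasurable
      · rintro ⟨b, x, y⟩
        rcases Int.units_eq_one_or (stripVal a b x) with h | h <;>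
        rcases Int.units_eq_one_or (stripVal a b y) with h' | h' <;> simp [h, h']
  have hmark := mul_meas_ge_le_integral_of_nonneg (μ := uniformOn (Set.univ : Set (Fin s → ℤˣ)))
    (f := G) (ae_of_all _ fun b => sq_nonneg _) Integrable.of_finite 1
  rw [one_mul, hGint] at hmark
  -- The integral is `2 - 2 * volume.real (minusSet a b)`, which exceeds `1` here.
  have hsub : {b : Fin s → ℤˣ | volume.real (minusSet a b) < 1 / 2} ⊆ {b | 1 ≤ G b} := by
    intro b hb
    simp only [Set.mem_ofPred_eq, hG, integral_stripVal] at hb ⊢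
    nlinarith
  refine (measure_mono hsub).trans ?_
  rw [measureReal_def, measureReal_def] at hmark
  exact (ENNReal.toReal_le_toReal (measure_ne_top _ _) (measure_ne_top _ _)).1 hmark

/-- The expected area of the set of pairs of points in a common strip: the band `|x - y| < τ`
contributes at most `4 τ`, and off it the probability is exponentially small. -/
theorem lintegral_sameStrip_le (m : ℕ) {τ : ℝ} (hτ : 0 < τ) :
    ∫⁻ a, (segLaw.prod segLaw) {p : ℝ × ℝ | stripIndex a p.1 = stripIndex a p.2}
        ∂(Measure.pi fun _ : Fin m => unifLaw) ≤
      ENNReal.ofReal (4 * τ + 4 * Real.exp (-(m * τ / 2))) := by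
  set S : Set ((Fin m → ℝ) × ℝ × ℝ) := {q | stripIndex q.1 q.2.1 = stripIndex q.1 q.2.2} with hS
  have hidx : Measurable fun q : (Fin m → ℝ) × ℝ => stripIndex q.1 q.2 :=
    measurable_stripIndex measurable_fst measurable_snd
  have hSm : MeasurableSet S := measurableSet_eq_fun
    (hidx.comp (by fun_prop : Measurable fun q : (Fin m → ℝ) × ℝ × ℝ => (q.1, q.2.1)))
    (hidx.comp (by fun_prop : Measurable fun q : (Fin m → ℝ) × ℝ × ℝ => (q.1, q.2.2)))
  have h1 := Measure.prod_apply (μ := Measure.pi fun _ : Fin m => unifLaw)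
    (ν := segLaw.prod segLaw) hSm
  have h2 := Measure.prod_apply_symm (μ := Measure.pi fun _ : Fin m => unifLaw)
    (ν := segLaw.prod segLaw) hSm
  change _ = ∫⁻ a, (segLaw.prod segLaw) {p : ℝ × ℝ | stripIndex a p.1 = stripIndex a p.2}
        ∂(Measure.pi fun _ : Fin m => unifLaw) at h1
  rw [← h1, h2, lintegral_prod _ (measurable_measure_prodMk_right hSm).aemeasurable]
  set ε := Real.exp (-(m * τ / 2)) with hε
  have hin : ∀ x ∈ Set.Ioc (-1 : ℝ) 1, (∫⁻ y, (Measure.pi fun _ : Fin m => unifLaw)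
      ((fun a => (a, x, y)) ⁻¹' S) ∂segLaw) ≤ ENNReal.ofReal (2 * τ + 2 * ε) := by
    intro x hx
    have hpt : ∀ y ∈ Set.Ioc (-1 : ℝ) 1, (Measure.pi fun _ : Fin m => unifLaw)
      ((fun a => (a, x, y)) ⁻¹' S) ≤
        (Set.Ioo (x - τ) (x + τ)).indicator 1 y + ENNReal.ofReal ε := by
      intro y hy
      by_cases hxy : y ∈ Set.Ioo (x - τ) (x + τ)
      · rw [Set.indicator_of_mem hxy]
        exact prob_le_one.trans le_self_add
      · refine (sameStrip_le m ⟨hx.1.le, hx.2⟩ ⟨hy.1.le, hy.2⟩).trans (le_trans ?_ le_add_self)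
        refine ENNReal.ofReal_le_ofReal (Real.exp_le_exp.2 ?_)
        have : τ ≤ |x - y| := by
          by_contra hlt
          rw [not_le, abs_lt] at hlt
          exact hxy ⟨by linarith, by linarith⟩
        have := mul_le_mul_of_nonneg_left this (Nat.cast_nonneg (α := ℝ) m)
        linarith
    refine (setLIntegral_mono' measurableSet_Ioc hpt).trans ?_
    rw [lintegral_add_right _ measurable_const, lintegral_indicator_one measurableSet_Ioo,
      lintegral_const, Measure.restrict_apply_univ, Real.volume_Ioc,
      ENNReal.ofReal_add (by positivity) (by positivity)]
    gcongr
    · refine (Measure.restrict_apply_le _ _).trans ?_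
      rw [Real.volume_Ioo]
      exact ENNReal.ofReal_le_ofReal (by linarith)
    · rw [← ENNReal.ofReal_mul (by positivity)]
      exact ENNReal.ofReal_le_ofReal (by linarith)
  refine (setLIntegral_mono' measurableSet_Ioc hin).trans ?_
  rw [lintegral_const, Measure.restrict_apply_univ, Real.volume_Ioc, ← ENNReal.ofReal_mul (by positivity)]
  exact ENNReal.ofReal_le_ofReal (by linarith)

/-! ### Cut strip functions are far from linear juntas -/

/-- The function cut out by the values `F` on the vertical lines in rotated coordinates. -/
noncomputable def cutOf (F : ℝ → ℤˣ) (z x y : ℝ) : ℤˣ :=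
  if -1 < x ∧ x ≤ 1 then F x * sgn (y - z) else 1

theorem cutStripFun_eq_cutOf {s : ℕ} (ω : StripSeed s) (x : E 2) :
    cutStripFun ω x = cutOf (stripVal ω.2.1 ω.2.2.1) ω.2.2.2
      ⟪x, direction ω.1⟫ ⟪x, directionPerp ω.1⟫ := rfl

theorem cutStripFun_rotated {s : ℕ} (ω : StripSeed s) (t m n : ℝ) :
    cutStripFun ω (m • directionPerp t + n • direction t) =
      cutOf (stripVal ω.2.1 ω.2.2.1) ω.2.2.2
        (m * Real.sin (t - ω.1) + n * Real.cos (t - ω.1))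
        (m * Real.cos (t - ω.1) - n * Real.sin (t - ω.1)) := by
  rw [cutStripFun_eq_cutOf]
  simp only [inner_add_left, inner_smul_left, inner_directionPerp_direction,
    inner_direction_direction, inner_directionPerp_directionPerp, inner_direction_directionPerp,
    conj_trivial]
  congr 1
  ring

theorem cutOf_of_mem (F : ℝ → ℤˣ) (z : ℝ) {x : ℝ} (hx : x ∈ Set.Ioc (-1) 1) (y : ℝ) :
    cutOf F z x y = F x * sgn (y - z) := if_pos hx

theorem cutOf_of_one_lt (F : ℝ → ℤˣ) (z : ℝ) {x : ℝ} (hx : 1 < x) (y : ℝ) :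
    cutOf F z x y = 1 := if_neg fun h => absurd h.2 (not_le.2 hx)

theorem sgn_of_nonneg {y : ℝ} (h : 0 ≤ y) : sgn y = 1 := if_pos h

theorem sgn_of_neg {y : ℝ} (h : y < 0) : sgn y = -1 := if_neg (not_le.2 h)

theorem units_ne_neg (u : ℤˣ) : u ≠ -u := by
  rcases Int.units_eq_one_or u with rfl | rfl <;> decide

/-- Two points on opposite sides of the cut, and their translates on the same side of the cut:
exactly one of the two pairs is separated by the function. -/
theorem cutOf_ne_or_ne (F : ℝ → ℤˣ) {z x₁ x₂ y₁ y₂ : ℝ} (h₁ : x₁ ∈ Set.Ioc (-1) 1)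
    (h₂ : x₂ ∈ Set.Ioc (-1) 1) (hy : (z ≤ y₁ ∧ y₂ < z) ∨ (y₁ < z ∧ z ≤ y₂))
    (hy₁ : z ≤ y₁ + 1) (hy₂ : z ≤ y₂ + 1) :
    cutOf F z x₁ y₁ ≠ cutOf F z x₂ y₂ ∨ cutOf F z x₁ (y₁ + 1) ≠ cutOf F z x₂ (y₂ + 1) := by
  by_contra! hcon
  obtain ⟨e1, e2⟩ := hcon
  rw [cutOf_of_mem F z h₁, cutOf_of_mem F z h₂] at e1 e2
  rw [sgn_of_nonneg (by linarith), sgn_of_nonneg (by linarith)] at e2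
  rcases hy with ⟨a, b⟩ | ⟨a, b⟩
  · rw [sgn_of_nonneg (by linarith), sgn_of_neg (by linarith)] at e1
    simp only [mul_one, mul_neg] at e1 e2
    exact units_ne_neg _ (e2.symm.trans e1)
  · rw [sgn_of_neg (by linarith), sgn_of_nonneg (by linarith)] at e1
    simp only [mul_one, mul_neg] at e1 e2
    exact units_ne_neg _ (e2.trans e1.symm)

/-- The set of separated pairs on a line, in rotated coordinates. -/
def cutSplit (F : ℝ → ℤˣ) (z c σ : ℝ) : Set (ℝ × ℝ × ℝ) :=
  {p | cutOf F z (p.1 * σ + p.2.1 * c) (p.1 * c - p.2.1 * σ) ≠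
    cutOf F z (p.1 * σ + p.2.2 * c) (p.1 * c - p.2.2 * σ)}

theorem splitSet_cutStripFun {s : ℕ} (ω : StripSeed s) (t : ℝ) :
    splitSet (cutStripFun ω) t = cutSplit (stripVal ω.2.1 ω.2.2.1) ω.2.2.2
      (Real.cos (t - ω.1)) (Real.sin (t - ω.1)) := by
  unfold splitSet cutSplit
  simp only [cutStripFun_rotated]

/-- The point `(m, n) = (c * z, -σ * z)` has rotated coordinates `(0, z)`, on the cut. Lines with
large `|σ|` cross the cut near it, so `n` and `n'` on either side of the crossing give points on
opposite sides. The translation raises both points by `1` along the strips, above the cut, without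
changing their strips. -/
theorem mem_cutSplit_or_translate_mem (F : ℝ → ℤˣ) {z c σ m n n' : ℝ} (hcs : c ^ 2 + σ ^ 2 = 1)
    (hc : c ^ 2 ≤ 1 / 2) (hm : |m - c * z| ≤ 1 / 8)
    (hn : n + σ * z ∈ Set.Icc (-(1 / 2) : ℝ) (-(1 / 4)))
    (hn' : n' + σ * z ∈ Set.Icc (1 / 4 : ℝ) (1 / 2)) :
    (m, n, n') ∈ cutSplit F z c σ ∨ (m, n, n') + (c, -σ, -σ) ∈ cutSplit F z c σ := by
  -- The bounds `3/4` and `7/10` are rational substitutes for `1/√2`. Then `7/10 * 1/4 > 1/8 * 3/4`: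
  -- the displacement along the line outweighs the offset of the line.
  have hc1 : |c| ≤ 3 / 4 := abs_le_of_sq_le_sq (by norm_num; linarith) (by norm_num)
  have hσ1 : |σ| ≤ 1 := abs_le_of_sq_le_sq (by nlinarith) (by norm_num)
  have hσabs : 7 / 10 ≤ |σ| := by
    by_contra hlt
    nlinarith [abs_nonneg σ, sq_abs σ]
  have e1 : ∀ n, m * σ + n * c = (m - c * z) * σ + (n + σ * z) * c := by
    intro n; ring
  have e2 : ∀ n, m * c - n * σ = z + (m - c * z) * c - (n + σ * z) * σ := by
    intro n; linear_combination z * hcs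
  have b1 : |(m - c * z) * σ| ≤ 1 / 8 * 1 := by
    rw [abs_mul]; exact mul_le_mul hm hσ1 (abs_nonneg _) (by norm_num)
  have b2 : |(m - c * z) * c| ≤ 1 / 8 * (3 / 4) := by
    rw [abs_mul]; exact mul_le_mul hm hc1 (abs_nonneg _) (by norm_num)
  have b3 : ∀ n, |n + σ * z| ≤ 1 / 2 → |(n + σ * z) * c| ≤ 1 / 2 * (3 / 4) ∧
      |(n + σ * z) * σ| ≤ 1 / 2 * 1 := by
    intro n hn
    rw [abs_mul, abs_mul]
    exact ⟨mul_le_mul hn hc1 (abs_nonneg _) (by norm_num),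
      mul_le_mul hn hσ1 (abs_nonneg _) (by norm_num)⟩
  obtain ⟨b4, b5⟩ := b3 n (abs_le.2 ⟨hn.1, by linarith [hn.2]⟩)
  obtain ⟨b4', b5'⟩ := b3 n' (abs_le.2 ⟨by linarith [hn'.1], hn'.2⟩)
  rw [abs_le] at b1 b2 b4 b4' b5 b5'
  have hx : m * σ + n * c ∈ Set.Ioc (-1 : ℝ) 1 := by
    rw [e1]; exact ⟨by linarith [b1.1, b4.1], by linarith [b1.2, b4.2]⟩
  have hx' : m * σ + n' * c ∈ Set.Ioc (-1 : ℝ) 1 := by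
    rw [e1]; exact ⟨by linarith [b1.1, b4'.1], by linarith [b1.2, b4'.2]⟩
  have hy : (z ≤ m * c - n * σ ∧ m * c - n' * σ < z) ∨
      (m * c - n * σ < z ∧ z ≤ m * c - n' * σ) := by
    rw [e2, e2]
    generalize n + σ * z = k at *
    generalize n' + σ * z = k' at *
    generalize (m - c * z) * c = l at *
    rcases le_total 0 σ with h0 | h0
    · rw [abs_of_nonneg h0] at hσabs
      have p := mul_le_mul (by linarith [hn.2] : 1 / 4 ≤ -k) hσabs (by norm_num) (by linarith [hn.2])
      have p' := mul_le_mul hn'.1 hσabs (by norm_num) (by linarith [hn'.1])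
      exact Or.inl ⟨by linarith [b2.1], by linarith [b2.2]⟩
    · rw [abs_of_nonpos h0] at hσabs
      have p := mul_le_mul (by linarith [hn.2] : 1 / 4 ≤ -k) hσabs (by norm_num) (by linarith [hn.2])
      have p' := mul_le_mul hn'.1 hσabs (by norm_num) (by linarith [hn'.1])
      exact Or.inr ⟨by linarith [b2.2], by linarith [b2.1]⟩
  refine (cutOf_ne_or_ne F hx hx' hy (by rw [e2]; linarith [b2.1, b5.2])
    (by rw [e2]; linarith [b2.1, b5'.2])).imp id fun h => ?_
  show cutOf F z ((m + c) * σ + (n + -σ) * c) ((m + c) * c - (n + -σ) * σ) ≠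
    cutOf F z ((m + c) * σ + (n' + -σ) * c) ((m + c) * c - (n' + -σ) * σ)
  have r1 : ∀ n, (m + c) * σ + (n + -σ) * c = m * σ + n * c := fun n => by ring
  have r2 : ∀ n, (m + c) * c - (n + -σ) * σ = m * c - n * σ + 1 := fun n => by
    linear_combination hcs
  rwa [r1, r1, r2, r2]

theorem mem_cube {R m n n' : ℝ} (hm : |m| ≤ R) (hn : |n| ≤ R) (hn' : |n'| ≤ R) :
    (m, n, n') ∈ cube R :=
  ⟨abs_le.1 hm, abs_le.1 hn, abs_le.1 hn'⟩

/-- Supplies the translation invariance used to compare a set of pairs with its translate. -/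
instance isAddHaarMeasure_volume_triple : (volume : Measure (ℝ × ℝ × ℝ)).IsAddHaarMeasure :=
  Measure.prod.instIsAddHaarMeasure volume volume

/-- A box of volume `1/64` is covered by the separated set and a translate of it, so the separated
set has at least half that volume, whatever the strip signs. -/
theorem volume_cutSplit_vertical (F : ℝ → ℤˣ) {z c σ : ℝ} (hz : z ∈ Set.Icc (-1 : ℝ) 1)
    (hcs : c ^ 2 + σ ^ 2 = 1) (hc : c ^ 2 ≤ 1 / 2) :
    ENNReal.ofReal (1 / 128) ≤ volume (cutSplit F z c σ ∩ cube 8) := by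
  have hc1 : |c| ≤ 1 := abs_le_of_sq_le_sq (by nlinarith) (by norm_num)
  have hσ1 : |σ| ≤ 1 := abs_le_of_sq_le_sq (by nlinarith) (by norm_num)
  have hz1 : |z| ≤ 1 := abs_le.2 hz
  have hm₀b : |c * z| ≤ 1 := by rw [abs_mul]; exact mul_le_one₀ hc1 (abs_nonneg _) hz1
  have hn₀b : |σ * z| ≤ 1 := by rw [abs_mul]; exact mul_le_one₀ hσ1 (abs_nonneg _) hz1
  set P : Set (ℝ × ℝ × ℝ) := Set.Icc (c * z - 1 / 8) (c * z + 1 / 8) ×ˢ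
    Set.Icc (-(σ * z) - 1 / 2) (-(σ * z) - 1 / 4) ×ˢ
      Set.Icc (-(σ * z) + 1 / 4) (-(σ * z) + 1 / 2) with hP
  have hPvol : volume P = ENNReal.ofReal (1 / 64) := by
    rw [hP, Measure.volume_eq_prod, Measure.prod_prod, Measure.volume_eq_prod, Measure.prod_prod,
      Real.volume_Icc, Real.volume_Icc, Real.volume_Icc, ← ENNReal.ofReal_mul, ← ENNReal.ofReal_mul]
    · congr 1; ring
    · linarith
    · linarith
  set S := cutSplit F z c σ ∩ cube 8 with hS
  have hsub : P ⊆ S ∪ (fun p => p + (c, -σ, -σ)) ⁻¹' S := by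
    rintro ⟨m, n, n'⟩ ⟨⟨hm1, hm2⟩, ⟨hn1, hn2⟩, hn1', hn2'⟩
    simp only at hm1 hm2 hn1 hn2 hn1' hn2'
    rw [abs_le] at hc1 hσ1 hm₀b hn₀b
    have hmb : |m| ≤ 2 := abs_le.2 ⟨by linarith [hm₀b.1], by linarith [hm₀b.2]⟩
    have hnb : |n| ≤ 2 := abs_le.2 ⟨by linarith [hn₀b.2], by linarith [hn₀b.1]⟩
    have hnb' : |n'| ≤ 2 := abs_le.2 ⟨by linarith [hn₀b.2], by linarith [hn₀b.1]⟩
    rcases mem_cutSplit_or_translate_mem F (n := n) (n' := n') hcs hc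
      (abs_le.2 ⟨by linarith, by linarith⟩ : |m - c * z| ≤ 1 / 8)
      ⟨by linarith, by linarith⟩ ⟨by linarith, by linarith⟩ with h | h
    · exact Or.inl ⟨h, mem_cube (hmb.trans (by norm_num)) (hnb.trans (by norm_num))
        (hnb'.trans (by norm_num))⟩
    · refine Or.inr ⟨h, mem_cube ?_ ?_ ?_⟩
      · exact (abs_add_le _ _).trans (by linarith [abs_le.2 hc1])
      · exact (abs_add_le _ _).trans (by rw [abs_neg]; linarith [abs_le.2 hσ1])
      · exact (abs_add_le _ _).trans (by rw [abs_neg]; linarith [abs_le.2 hσ1])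
  have hle : volume P ≤ volume S + volume S := by
    refine (measure_mono hsub).trans ((measure_union_le _ _).trans ?_)
    rw [measure_preimage_add_right]
  rw [hPvol] at hle
  by_contra hlt
  rw [not_le] at hlt
  have := hle.trans_lt (ENNReal.add_lt_add hlt hlt)
  rw [← ENNReal.ofReal_add (by norm_num) (by norm_num)] at this
  norm_num at this

theorem volume_affine_preimage {c : ℝ} (hc : c ≠ 0) (hc1 : |c| ≤ 1) (k : ℝ) (B : Set ℝ) :
    volume B ≤ volume ((fun n => k + n * c) ⁻¹' B) := by
  have : (fun n => k + n * c) ⁻¹' B = (fun n => n * c) ⁻¹' ((fun x => k + x) ⁻¹' B) := rfl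
  rw [this, Real.volume_preimage_mul_right hc, measure_preimage_add]
  refine le_mul_of_one_le_left' ?_
  rw [← ENNReal.ofReal_one]
  refine ENNReal.ofReal_le_ofReal ?_
  rw [abs_inv]
  exact (one_le_inv₀ (abs_pos.2 hc)).2 hc1

/-- Such a line crosses all strips and then leaves them. For suitable `m` it does so above the cut:
one point is chosen in a strip of value `-1`, the other beyond the strips, where the value is `1`.
-/
theorem volume_cutSplit_horizontal {F : ℝ → ℤˣ} (hF : Measurable F) {z c σ : ℝ}
    (hz : z ∈ Set.Icc (-1 : ℝ) 1) (hcs : c ^ 2 + σ ^ 2 = 1) (hc : 1 / 2 ≤ c ^ 2)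
    (hvol : 1 / 2 ≤ volume.real {x | x ∈ Set.Ioc (-1) 1 ∧ F x = -1}) :
    ENNReal.ofReal (1 / 128) ≤ volume (cutSplit F z c σ ∩ cube 8) := by
  have hc1 : |c| ≤ 1 := abs_le_of_sq_le_sq (by nlinarith) (by norm_num)
  have hσ1 : |σ| ≤ 1 := abs_le_of_sq_le_sq (by nlinarith) (by norm_num)
  have hc0 : c ≠ 0 := by rintro rfl; norm_num at hc
  obtain ⟨c_lo, c_hi⟩ := abs_le.1 hc1
  obtain ⟨σ_lo, σ_hi⟩ := abs_le.1 hσ1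
  obtain ⟨z_lo, z_hi⟩ := hz
  set B : Set ℝ := {x | x ∈ Set.Ioc (-1) 1 ∧ F x = -1} with hB
  have hBm : MeasurableSet B :=
    measurableSet_Ioc.inter (measurableSet_eq_fun hF measurable_const)
  -- `m` is given the sign of `c` and size at least `2`, so that `m - σ * x` has size at least `1 ≥
  -- |c|`; then `y ≥ 1 ≥ z`.
  obtain ⟨I, hIm, hIvol, hI⟩ : ∃ I : Set ℝ, MeasurableSet I ∧ volume I = 1 ∧
      ∀ m ∈ I, |m| ≤ 3 ∧ ∀ x : ℝ, |x| ≤ 1 → ∀ y : ℝ, y * c = m - σ * x → 1 ≤ y := by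
    rcases lt_or_gt_of_ne hc0 with h | h
    · refine ⟨Set.Icc (-3) (-2), measurableSet_Icc, by rw [Real.volume_Icc]; norm_num, ?_⟩
      rintro m ⟨h1, h2⟩
      refine ⟨abs_le.2 ⟨by linarith, by linarith⟩, fun x hx y hy => ?_⟩
      have : |σ * x| ≤ 1 := by
        rw [abs_mul]; exact mul_le_one₀ hσ1 (abs_nonneg _) hx
      have := abs_le.1 this
      nlinarith
    · refine ⟨Set.Icc 2 3, measurableSet_Icc, by rw [Real.volume_Icc]; norm_num, ?_⟩
      rintro m ⟨h1, h2⟩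
      refine ⟨abs_le.2 ⟨by linarith, by linarith⟩, fun x hx y hy => ?_⟩
      have : |σ * x| ≤ 1 := by
        rw [abs_mul]; exact mul_le_one₀ hσ1 (abs_nonneg _) hx
      have := abs_le.1 this
      nlinarith
  set A : Set (ℝ × ℝ × ℝ) := {p | p.1 ∈ I ∧ p.1 * σ + p.2.1 * c ∈ B ∧
    p.1 * σ + p.2.2 * c ∈ Set.Ioc (1 : ℝ) 2} with hA
  have hAm : MeasurableSet A := by
    refine (measurable_fst hIm).inter (MeasurableSet.inter ?_ ?_)
    · exact (by fun_prop : Measurable fun p : ℝ × ℝ × ℝ => p.1 * σ + p.2.1 * c) hBm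
    · exact (by fun_prop : Measurable fun p : ℝ × ℝ × ℝ => p.1 * σ + p.2.2 * c) measurableSet_Ioc
  -- This fixes the cube: `|n * c| ≤ 5` and `c ^ 2 ≥ 1/2` give `n ^ 2 ≤ 50 < 8 ^ 2`.
  have hbound : ∀ m x n : ℝ, |m| ≤ 3 → |x| ≤ 2 → m * σ + n * c = x → -8 ≤ n ∧ n ≤ 8 := by
    intro m x n hm hx h
    have h1 : |m * σ| ≤ 3 := by
      rw [abs_mul]; nlinarith [abs_nonneg m, abs_nonneg σ]
    have h2 : |n * c| ≤ 5 := by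
      have : n * c = x - m * σ := by linarith
      rw [this]
      exact (abs_sub _ _).trans (by linarith)
    have h3 : (n * c) ^ 2 ≤ 25 := by
      rw [← sq_abs]; nlinarith [abs_nonneg (n * c)]
    have h4 : n ^ 2 ≤ 8 ^ 2 := by nlinarith [sq_nonneg n]
    exact abs_le.1 (abs_le_of_sq_le_sq h4 (by norm_num))
  have hsub : A ⊆ cutSplit F z c σ ∩ cube 8 := by
    rintro ⟨m, n, n'⟩ ⟨hm, hn, hn'⟩
    simp only at hm hn hn'
    obtain ⟨hm3, hmy⟩ := hI m hm
    have hx1 : |m * σ + n * c| ≤ 1 := abs_le.2 ⟨hn.1.1.le, hn.1.2⟩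
    have hx2 : |m * σ + n' * c| ≤ 2 := abs_le.2 ⟨by linarith [hn'.1], hn'.2⟩
    have hb := hbound m _ n hm3 (hx1.trans (by norm_num)) rfl
    have hb' := hbound m _ n' hm3 hx2 rfl
    have hy := hmy _ hx1 (m * c - n * σ) (by linear_combination m * hcs)
    have hmb := abs_le.1 hm3
    refine ⟨?_, ⟨by simp only; linarith, by simp only; linarith⟩, hb, hb'⟩
    show cutOf F z (m * σ + n * c) (m * c - n * σ) ≠ cutOf F z (m * σ + n' * c) (m * c - n' * σ)
    rw [cutOf_of_mem F z hn.1, cutOf_of_one_lt F z hn'.1, hn.2, sgn_of_nonneg (by linarith)]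
    decide
  refine le_trans ?_ (measure_mono hsub)
  rw [Measure.volume_eq_prod, Measure.prod_apply hAm]
  -- For fixed `m` the conditions on `n` and `n'` decouple, and pulling back along a map of slope
  -- `|c| ≤ 1` does not decrease length.
  have hsec : ∀ m ∈ I, ENNReal.ofReal (1 / 2) ≤ volume (Prod.mk m ⁻¹' A) := by
    intro m hm
    have : Prod.mk m ⁻¹' A = ((fun n => m * σ + n * c) ⁻¹' B) ×ˢ
        ((fun n => m * σ + n * c) ⁻¹' Set.Ioc (1 : ℝ) 2) := by
      ext ⟨n, n'⟩
      simp [hA, hm]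
    rw [this, Measure.volume_eq_prod, Measure.prod_prod]
    have h1 := volume_affine_preimage hc0 hc1 (m * σ) B
    have h2 := volume_affine_preimage hc0 hc1 (m * σ) (Set.Ioc (1 : ℝ) 2)
    have h3 : ENNReal.ofReal (1 / 2) ≤ volume B := (ENNReal.ofReal_le_iff_le_toReal
      (measure_ne_top_of_subset (fun x hx => hx.1) (measure_Ioc_lt_top (a := (-1 : ℝ)) (b := 1)).ne)).2 hvol
    calc ENNReal.ofReal (1 / 2) = ENNReal.ofReal (1 / 2) * ENNReal.ofReal (2 - 1) := by norm_num
      _ ≤ _ := by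
        rw [Real.volume_Ioc] at h2
        gcongr
        exact h3.trans h1
  calc ENNReal.ofReal (1 / 128) ≤ ENNReal.ofReal (1 / 2) := ENNReal.ofReal_le_ofReal (by norm_num)
    _ = ∫⁻ m in I, ENNReal.ofReal (1 / 2) := by rw [setLIntegral_const, hIvol, mul_one]
    _ ≤ ∫⁻ m in I, volume (Prod.mk m ⁻¹' A) := setLIntegral_mono' hIm hsec
    _ ≤ _ := setLIntegral_le_lintegral _ _

/-- The constant of separation for cut strip functions. -/
noncomputable def sepConst : ℝ := gaussianPDFReal 0 1 8 ^ 3 / 256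

theorem sepConst_pos : 0 < sepConst :=
  div_pos (pow_pos (gaussianPDFReal_pos 0 1 8 one_ne_zero) 3) (by norm_num)

theorem gaussTriple_real_ge {S : Set (ℝ × ℝ × ℝ)} {R v : ℝ}
    (h : ENNReal.ofReal v ≤ volume (S ∩ cube R)) :
    gaussianPDFReal 0 1 R ^ 3 * v ≤ gaussTriple.real S := by
  have h0 := gaussianPDFReal_nonneg 0 1 R
  have h1 := le_gaussTriple R S
  have h2 : ENNReal.ofReal (gaussianPDFReal 0 1 R ^ 3 * v) ≤ gaussTriple S := by
    rw [ENNReal.ofReal_mul (pow_nonneg h0 3), ENNReal.ofReal_pow h0]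
    exact (mul_le_mul_right h _).trans h1
  exact (ENNReal.ofReal_le_iff_le_toReal (measure_ne_top _ _)).1 h2

theorem measurable_cutStripFun_right {s : ℕ} (ω : StripSeed s) :
    Measurable fun x => cutStripFun ω x :=
  (measurable_cutStripFun s).of_uncurry_left

theorem measurable_stripFun_right {s : ℕ} (ω : StripSeed s) :
    Measurable fun x => stripFun ω x :=
  (measurable_stripFun s).of_uncurry_left

/-- A cut strip function is far from linear juntas as soon as the uncut function takes the value
`-1` on a set of strips of total width `1 / 2`. -/
theorem isFar_cutStripFun_comp {d : ℕ} (ι : E 2 →ₗᵢ[ℝ] E d) {s : ℕ} (ω : StripSeed s)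
    (hz : ω.2.2.2 ∈ Set.Icc (-1 : ℝ) 1) (hvol : 1 / 2 ≤ volume.real (minusSet ω.2.1 ω.2.2.1)) :
    IsFarFromLinearJuntas 1 sepConst fun x => cutStripFun ω (planeProj ι x) := by
  refine isFarFromLinearJuntas_comp_planeProj ι (measurable_cutStripFun_right ω) fun t => ?_
  have h : ENNReal.ofReal (1 / 128) ≤ volume (splitSet (cutStripFun ω) t ∩ cube 8) := by
    rw [splitSet_cutStripFun]
    rcases le_total (Real.cos (t - ω.1) ^ 2) (1 / 2) with hc | hc
    · exact volume_cutSplit_vertical _ hz (Real.cos_sq_add_sin_sq _) hc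
    · exact volume_cutSplit_horizontal (measurable_stripVal_right _ _) hz
        (Real.cos_sq_add_sin_sq _) hc hvol
  have := gaussTriple_real_ge h
  unfold sepConst
  linarith

/-- The seeds for which the cut strip function may be close to a linear junta. -/
def badSeeds (s : ℕ) : Set (StripSeed s) :=
  {ω | ω.2.2.2 ∉ Set.Icc (-1 : ℝ) 1} ∪ {ω | volume.real (minusSet ω.2.1 ω.2.2.1) < 1 / 2}

theorem stripLaw_eq (s : ℕ) : stripLaw s = angleLaw.prod
    ((Measure.pi fun _ : Fin (s - 1) => unifLaw).prod
      ((uniformOn (Set.univ : Set (Fin s → ℤˣ))).prod unifLaw)) := rfl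

theorem measurableSet_minusSet_lt (s : ℕ) :
    MeasurableSet {p : (Fin (s - 1) → ℝ) × (Fin s → ℤˣ) | volume.real (minusSet p.1 p.2) < 1 / 2} := by
  have h : MeasurableSet {q : ((Fin (s - 1) → ℝ) × (Fin s → ℤˣ)) × ℝ |
      q.2 ∈ Set.Ioc (-1 : ℝ) 1 ∧ stripVal q.1.1 q.1.2 q.2 = -1} := by
    refine (measurable_snd measurableSet_Ioc).inter (measurableSet_eq_fun ?_ measurable_const)
    exact (measurable_stripVal s).comp (by fun_prop :
      Measurable fun q : ((Fin (s - 1) → ℝ) × (Fin s → ℤˣ)) × ℝ => (q.1.1, q.1.2, q.2))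
  exact measurableSet_lt (measurable_measure_prodMk_left h).ennreal_toReal measurable_const

/-- A height outside `[-1, 1]` has probability zero. For the minus set, the band width `τ =
s^(-1/2)` makes the exponential term at most `4 * τ` as well, for a total of `4 * τ + 16 * τ`. -/
theorem stripLaw_badSeeds_le {s : ℕ} (hs : 1 ≤ s) :
    stripLaw s (badSeeds s) ≤ ENNReal.ofReal (20 * (s : ℝ) ^ (-(1 / 2) : ℝ)) := by
  have hz : stripLaw s {ω | ω.2.2.2 ∉ Set.Icc (-1 : ℝ) 1} = 0 := by
    have h1 : MeasurePreserving (fun ω : StripSeed s => ω.2.2.2) (stripLaw s) unifLaw := by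
      rw [stripLaw_eq]
      exact measurePreserving_snd.comp (measurePreserving_snd.comp measurePreserving_snd)
    have : {ω : StripSeed s | ω.2.2.2 ∉ Set.Icc (-1 : ℝ) 1} =
        (fun ω : StripSeed s => ω.2.2.2) ⁻¹' (Set.Icc (-1 : ℝ) 1)ᶜ := rfl
    rw [this, h1.measure_preimage measurableSet_Icc.compl.nullMeasurableSet, unifLaw_apply]
    simp
  refine (measure_union_le _ _).trans ?_
  rw [hz, zero_add]
  have h2 : MeasurePreserving (fun ω : StripSeed s => (ω.2.1, ω.2.2.1)) (stripLaw s)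
      ((Measure.pi fun _ : Fin (s - 1) => unifLaw).prod
        (uniformOn (Set.univ : Set (Fin s → ℤˣ)))) := by
    rw [stripLaw_eq]
    exact ((MeasurePreserving.id _).prod measurePreserving_fst).comp measurePreserving_snd
  have e : {ω : StripSeed s | volume.real (minusSet ω.2.1 ω.2.2.1) < 1 / 2} =
      (fun ω : StripSeed s => (ω.2.1, ω.2.2.1)) ⁻¹'
        {p | volume.real (minusSet p.1 p.2) < 1 / 2} := rfl
  have hs0 : (0 : ℝ) < s := by exact_mod_cast hs
  set τ : ℝ := (s : ℝ) ^ (-(1 / 2) : ℝ) with hτ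
  have hτ0 : 0 < τ := Real.rpow_pos_of_pos hs0 _
  -- For `s = 1` there are no cuts, but the claimed bound exceeds `1`. From `s = 2` on, `s - 1 ≥ s /
  -- 2`.
  rcases hs.eq_or_lt with h1 | hs2
  · refine prob_le_one.trans ?_
    rw [hτ, ← h1]
    norm_num
  rw [e, h2.measure_preimage (measurableSet_minusSet_lt s).nullMeasurableSet,
    Measure.prod_apply (measurableSet_minusSet_lt s)]
  refine (lintegral_mono fun a => prob_minusSet_lt_le hs a).trans
    ((lintegral_sameStrip_le (s - 1) hτ0).trans (ENNReal.ofReal_le_ofReal ?_))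
  have hm : (s : ℝ) / 2 ≤ ((s - 1 : ℕ) : ℝ) := by
    have : (2 : ℝ) ≤ s := by exact_mod_cast hs2
    rw [Nat.cast_sub hs]; push_cast; linarith
  have hττ : τ * τ = (s : ℝ)⁻¹ := by
    rw [hτ, ← Real.rpow_add hs0]; norm_num [Real.rpow_neg_one]
  have hge : 1 / (4 * τ) ≤ ((s - 1 : ℕ) : ℝ) * τ / 2 := by
    have : 1 / (4 * τ) = s / 2 * τ / 2 := by
      field_simp
      have : τ ^ 2 * s = 1 := by rw [pow_two, hττ, inv_mul_cancel₀ hs0.ne']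
      linarith
    rw [this]; gcongr
  have hexp : Real.exp (-(((s - 1 : ℕ) : ℝ) * τ / 2)) ≤ 4 * τ := by
    refine (Real.exp_le_exp.2 (neg_le_neg hge)).trans ((exp_neg_le_inv (by positivity)).trans ?_)
    simp
  linarith

theorem far_of_notMem_badSeeds {d : ℕ} (ι : E 2 →ₗᵢ[ℝ] E d) {s : ℕ} {ω : StripSeed s}
    (hω : ω ∉ badSeeds s) :
    IsFarFromLinearJuntas 1 sepConst fun x => cutStripFun ω (planeProj ι x) := by
  simp only [badSeeds, Set.mem_union, Set.mem_ofPred_eq, not_or, not_not, not_lt] at hω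
  exact isFar_cutStripFun_comp ι ω hω.1 hω.2

theorem cutStripFun_far_with_high_probability {s : ℕ} (hs : 1 ≤ s) :
    stripLaw s {ω | ¬ IsFarFromLinearJuntas 1 sepConst (cutStripFun ω)} ≤
      ENNReal.ofReal (20 * (s : ℝ) ^ (-(1 / 2) : ℝ)) := by
  refine (measure_mono fun ω hω => ?_).trans (stripLaw_badSeeds_le hs)
  by_contra hcon
  refine hω ?_
  have := far_of_notMem_badSeeds LinearIsometry.id hcon
  simpa only [planeProj_id] using this

/-! ### Closeness of the query distributions -/

/-- At most four zeros of the cosine matter; by Jordan's inequality the set near each is an interval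
of length `π * τ`. The total `4 * π * τ` is divided by `2 * π`. -/
theorem angle_close_to_orthogonal (t₀ : ℝ) {τ : ℝ} (hτ : 0 ≤ τ) :
    angleLaw {t | |Real.cos (t - t₀)| ≤ τ} ≤ ENNReal.ofReal (2 * τ) := by
  set c₀ := t₀ + Real.pi / 2 with hc₀
  set k₀ : ℤ := round (-c₀ / Real.pi) with hk₀
  have hpi := Real.pi_pos
  have hsub : Set.Ico 0 (2 * Real.pi) ∩ {t | |Real.cos (t - t₀)| ≤ τ} ⊆
      ⋃ k ∈ Finset.Icc k₀ (k₀ + 3), Set.Icc (c₀ + k * Real.pi - Real.pi * τ / 2)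
        (c₀ + k * Real.pi + Real.pi * τ / 2) := by
    rintro t ⟨⟨ht0, ht1⟩, ht⟩
    set k : ℤ := round ((t - c₀) / Real.pi) with hk
    have h1 := abs_le.1 (abs_sub_round ((t - c₀) / Real.pi))
    have h2 := abs_le.1 (abs_sub_round (-c₀ / Real.pi))
    rw [← hk] at h1
    rw [← hk₀] at h2
    have e : (t - c₀) / Real.pi = t / Real.pi + -c₀ / Real.pi := by ring
    have ht0' : 0 ≤ t / Real.pi := by positivity
    have ht1' : t / Real.pi < 2 := (div_lt_iff₀ hpi).2 ht1
    have hk1 : (k₀ : ℝ) - 1 ≤ k := by linarith [h1.1, h1.2, h2.1, h2.2]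
    have hk2 : (k : ℝ) < k₀ + 3 := by linarith [h1.1, h1.2, h2.1, h2.2]
    have hk2' : k < k₀ + 3 := by exact_mod_cast hk2
    have hmono : k₀ ≤ k := by
      rw [hk, hk₀, round_eq, round_eq]
      exact Int.floor_le_floor (by linarith)
    set r := t - c₀ - k * Real.pi with hr
    have hr1 : |r| ≤ Real.pi / 2 := by
      have : r = ((t - c₀) / Real.pi - k) * Real.pi := by rw [hr]; field_simp
      rw [this, abs_mul, abs_of_pos hpi]
      have := mul_le_mul_of_nonneg_right (abs_le.2 h1) hpi.le
      linarith
    have hcos : |Real.cos (t - t₀)| = |Real.sin r| := by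
      have : t - t₀ = (r + k * Real.pi) + Real.pi / 2 := by rw [hr, hc₀]; ring
      rw [this, Real.cos_add_pi_div_two, abs_neg, Real.sin_add_int_mul_pi, abs_mul, abs_zpow]
      simp
    -- Jordan's inequality `|sin r| ≥ 2 * |r| / π`, where `r` is the distance to the nearest zero,
    -- with sign.
    have h3 := Real.mul_abs_le_abs_sin hr1
    rw [← hcos] at h3
    have h4 : |r| ≤ Real.pi * τ / 2 := by
      have h5 := mul_le_mul_of_nonneg_left (h3.trans ht) (by positivity : 0 ≤ Real.pi / 2)
      have : Real.pi / 2 * (2 / Real.pi * |r|) = |r| := by field_simp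
      linarith
    rw [abs_le] at h4
    simp only [Set.mem_iUnion, Finset.mem_Icc]
    exact ⟨k, ⟨hmono, hk2'.le⟩, by linarith [h4.1], by linarith [h4.2]⟩
  rw [cond_apply measurableSet_Ico, Real.volume_Ico, ← ENNReal.div_eq_inv_mul]
  refine ENNReal.div_le_of_le_mul ?_
  rw [← ENNReal.ofReal_mul (by positivity)]
  refine (measure_mono hsub).trans ((measure_biUnion_finset_le _ _).trans ?_)
  simp only [Real.volume_Icc]
  rw [← ENNReal.ofReal_sum_of_nonneg (fun k _ => by nlinarith)]
  refine ENNReal.ofReal_le_ofReal ?_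
  have : ∀ k : ℤ, c₀ + k * Real.pi + Real.pi * τ / 2 - (c₀ + k * Real.pi - Real.pi * τ / 2) =
      Real.pi * τ := fun k => by ring
  simp only [this, Finset.sum_const, Int.card_Icc, nsmul_eq_mul]
  have : (k₀ + 3 + 1 - k₀).toNat = 4 := by omega
  rw [this]
  push_cast
  linarith

/-- The unsigned part of the randomness: angle, cuts and height. -/
noncomputable abbrev cutLaw (m : ℕ) : Measure (ℝ × (Fin m → ℝ) × ℝ) :=
  angleLaw.prod ((Measure.pi fun _ : Fin m => unifLaw).prod unifLaw)

/-- The event that two points lie in the same strip, on different sides of the orthogonal cut. -/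
def splitPair (m : ℕ) (x y : E 2) : Set (ℝ × (Fin m → ℝ) × ℝ) :=
  {q | ⟪x, direction q.1⟫ ∈ Set.Ioc (-1 : ℝ) 1 ∧ ⟪y, direction q.1⟫ ∈ Set.Ioc (-1 : ℝ) 1 ∧
    stripIndex q.2.1 ⟪x, direction q.1⟫ = stripIndex q.2.1 ⟪y, direction q.1⟫ ∧
    sgn (⟪x, directionPerp q.1⟫ - q.2.2) ≠ sgn (⟪y, directionPerp q.1⟫ - q.2.2)}

theorem measurableSet_splitPair (m : ℕ) (x y : E 2) : MeasurableSet (splitPair m x y) := by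
  have hd : ∀ x : E 2, Measurable fun q : ℝ × (Fin m → ℝ) × ℝ => ⟪x, direction q.1⟫ :=
    fun x => measurable_const.inner (measurable_direction.comp measurable_fst)
  have hp : ∀ x : E 2, Measurable fun q : ℝ × (Fin m → ℝ) × ℝ =>
      sgn (⟪x, directionPerp q.1⟫ - q.2.2) := fun x => measurable_sgn.comp
    ((measurable_const.inner (measurable_directionPerp.comp measurable_fst)).sub (by fun_prop))
  refine (hd x measurableSet_Ioc).inter ((hd y measurableSet_Ioc).inter (MeasurableSet.inter ?_ ?_))
  · exact measurableSet_eq_fun (measurable_stripIndex (by fun_prop) (hd x))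
      (measurable_stripIndex (by fun_prop) (hd y))
  · exact (measurableSet_eq_fun (hp x) (hp y)).compl

theorem unifLaw_sgn_ne_le (p q : ℝ) :
    unifLaw {z | sgn (p - z) ≠ sgn (q - z)} ≤ ENNReal.ofReal (|p - q| / 2) := by
  wlog h : p ≤ q generalizing p q
  · have := this q p (le_of_not_ge h)
    rw [abs_sub_comm]
    convert this using 4
    exact ne_comm
  have hsub : {z | sgn (p - z) ≠ sgn (q - z)} ⊆ Set.Ioc p q := by
    intro z hz
    by_contra hcon
    refine hz ?_
    rcases le_or_gt z p with h1 | h1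
    · rw [sgn_of_nonneg (by linarith), sgn_of_nonneg (by linarith)]
    · have h2 : q < z := by
        by_contra h3
        exact hcon ⟨h1, not_lt.1 h3⟩
      rw [sgn_of_neg (by linarith), sgn_of_neg (by linarith)]
  rw [unifLaw_apply, abs_sub_comm, abs_of_nonneg (sub_nonneg.2 h), ENNReal.ofReal_div_of_pos two_pos]
  have h3 : volume (Set.Icc (-1) 1 ∩ {z | sgn (p - z) ≠ sgn (q - z)}) ≤ ENNReal.ofReal (q - p) := by
    rw [← Real.volume_Ioc]
    exact measure_mono (Set.inter_subset_right.trans hsub)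
  norm_num
  gcongr

/-- Nearby points are rarely on different sides of the orthogonal cut. -/
theorem cutLaw_splitPair_le_of_close (m : ℕ) {x y : E 2} {τ : ℝ} (hxy : ‖x - y‖ ≤ τ) :
    cutLaw m (splitPair m x y) ≤ ENNReal.ofReal (τ / 2) := by
  have hS := measurableSet_splitPair m x y
  rw [Measure.prod_apply hS]
  refine (lintegral_mono (g := fun _ => ENNReal.ofReal (τ / 2)) fun t => ?_).trans (by simp)
  rw [Measure.prod_apply (measurable_prodMk_left hS)]
  refine (lintegral_mono (g := fun _ => ENNReal.ofReal (τ / 2)) fun a => ?_).trans (by simp)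
  refine (measure_mono (t := {z | sgn (⟪x, directionPerp t⟫ - z) ≠ sgn (⟪y, directionPerp t⟫ - z)})
    fun z hz => hz.2.2.2).trans ((unifLaw_sgn_ne_le _ _).trans (ENNReal.ofReal_le_ofReal ?_))
  rw [← inner_sub_left]
  have := abs_real_inner_le_norm (x - y) (directionPerp t)
  rw [norm_directionPerp] at this
  linarith

/-- Distant points are rarely in the same strip. -/
theorem cutLaw_splitPair_le_of_far (m : ℕ) {x y : E 2} {τ : ℝ} (hτ : 0 ≤ τ) (hxy : τ ≤ ‖x - y‖) :
    cutLaw m (splitPair m x y) ≤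
      ENNReal.ofReal (2 * τ) + ENNReal.ofReal (Real.exp (-(m * τ ^ 2 / 2))) := by
  have hS := measurableSet_splitPair m x y
  rw [Measure.prod_apply hS]
  obtain ⟨t₀, ht₀⟩ := exists_eq_norm_smul_direction (x - y)
  -- For angles in `J` the projections of `x` and `y` may be close and nothing is claimed. For the
  -- others they are at least `τ ^ 2` apart.
  set J : Set ℝ := {t | |Real.cos (t - t₀)| ≤ τ} with hJ
  have hJm : MeasurableSet J := measurableSet_le (by fun_prop) measurable_const
  set ε := ENNReal.ofReal (Real.exp (-(m * τ ^ 2 / 2))) with hε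
  have hpt : ∀ t, ((Measure.pi fun _ : Fin m => unifLaw).prod unifLaw)
      (Prod.mk t ⁻¹' splitPair m x y) ≤ J.indicator 1 t + ε := by
    intro t
    by_cases ht : t ∈ J
    · rw [Set.indicator_of_mem ht]
      exact prob_le_one.trans le_self_add
    · rw [Set.indicator_of_notMem ht, zero_add]
      by_cases hin : ⟪x, direction t⟫ ∈ Set.Ioc (-1 : ℝ) 1 ∧ ⟪y, direction t⟫ ∈ Set.Ioc (-1 : ℝ) 1
      · have hsub : Prod.mk t ⁻¹' splitPair m x y ⊆
            {a | stripIndex a ⟪x, direction t⟫ = stripIndex a ⟪y, direction t⟫} ×ˢ Set.univ :=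
          fun q hq => ⟨hq.2.2.1, Set.mem_univ _⟩
        refine (measure_mono hsub).trans ?_
        rw [Measure.prod_prod, measure_univ, mul_one]
        refine (sameStrip_le m ⟨hin.1.1.le, hin.1.2⟩ ⟨hin.2.1.le, hin.2.2⟩).trans
          (ENNReal.ofReal_le_ofReal (Real.exp_le_exp.2 (neg_le_neg ?_)))
        rw [← inner_sub_left, ht₀, inner_smul_left, inner_direction_direction, abs_mul]
        have h1 : τ ≤ |Real.cos (t - t₀)| := (not_le.1 ht).le
        rw [← Real.cos_neg, neg_sub] at h1
        simp only [conj_trivial, abs_norm]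
        have : τ ^ 2 ≤ ‖x - y‖ * |Real.cos (t₀ - t)| := by
          rw [pow_two]; exact mul_le_mul hxy h1 hτ (norm_nonneg _)
        gcongr
      · have : Prod.mk t ⁻¹' splitPair m x y = ∅ := by
          rw [Set.eq_empty_iff_forall_notMem]
          exact fun q hq => hin ⟨hq.1, hq.2.1⟩
        rw [this, measure_empty]
        exact zero_le
  refine (lintegral_mono hpt).trans ?_
  rw [lintegral_add_right _ measurable_const, lintegral_indicator_one hJm, lintegral_const,
    measure_univ, mul_one]
  gcongr
  exact angle_close_to_orthogonal t₀ hτ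

/-- The threshold `τ = s^(-3/10)` serves both regimes: `τ / 2` for close pairs, and `2 * τ + 4 / (s
* τ ^ 2)` for distant ones, where `1 / (s * τ ^ 2) = s^(-4/10) ≤ τ`. -/
theorem cutLaw_splitPair_le {s : ℕ} (hs : 1 ≤ s) (x y : E 2) :
    cutLaw (s - 1) (splitPair (s - 1) x y) ≤
      ENNReal.ofReal (6 * (s : ℝ) ^ (-(3 / 10) : ℝ)) := by
  have hs0 : (0 : ℝ) < s := by exact_mod_cast hs
  have hs1 : (1 : ℝ) ≤ s := by exact_mod_cast hs
  set τ : ℝ := (s : ℝ) ^ (-(3 / 10) : ℝ) with hτ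
  have hτ0 : 0 < τ := Real.rpow_pos_of_pos hs0 _
  rcases le_total ‖x - y‖ τ with h | h
  · exact (cutLaw_splitPair_le_of_close _ h).trans (ENNReal.ofReal_le_ofReal (by linarith))
  rcases hs.eq_or_lt with h1 | hs2
  · refine prob_le_one.trans ?_
    rw [hτ, ← h1]
    norm_num
  refine (cutLaw_splitPair_le_of_far _ hτ0.le h).trans ?_
  rw [← ENNReal.ofReal_add (by positivity) (by positivity)]
  refine ENNReal.ofReal_le_ofReal ?_
  have hm : (s : ℝ) / 2 ≤ ((s - 1 : ℕ) : ℝ) := by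
    have : (2 : ℝ) ≤ s := by exact_mod_cast hs2
    rw [Nat.cast_sub hs]; push_cast; linarith
  have hinv : ((s : ℝ) * τ ^ 2)⁻¹ ≤ τ := by
    have e : ((s : ℝ) * τ ^ 2)⁻¹ = (s : ℝ) ^ (-(4 / 10) : ℝ) := by
      have : (s : ℝ) * τ ^ 2 = (s : ℝ) ^ (4 / 10 : ℝ) := by
        rw [hτ, ← Real.rpow_natCast, ← Real.rpow_mul hs0.le]
        nth_rewrite 1 [← Real.rpow_one (s : ℝ)]
        rw [← Real.rpow_add hs0]
        norm_num
      rw [this, Real.rpow_neg hs0.le]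
    rw [e, hτ]
    exact Real.rpow_le_rpow_of_exponent_le hs1 (by norm_num)
  have hexp : Real.exp (-(((s - 1 : ℕ) : ℝ) * τ ^ 2 / 2)) ≤ 4 * τ := by
    have h2 : s * τ ^ 2 / 4 ≤ ((s - 1 : ℕ) : ℝ) * τ ^ 2 / 2 := by
      have := mul_le_mul_of_nonneg_right hm (sq_nonneg τ)
      linarith
    refine (Real.exp_le_exp.2 (neg_le_neg h2)).trans ((exp_neg_le_inv (by positivity)).trans ?_)
    rw [inv_div, div_eq_mul_inv]
    linarith
  linarith

/-- If no strip contains queries on different sides of the cut, then the two functions have the same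
answers up to flipping the signs of some of the strips. -/
theorem exists_flip {s n : ℕ} (hs : 1 ≤ s) (x : Fin n → E 2) {t z : ℝ} {a : Fin (s - 1) → ℝ}
    (h : ∀ i j, (t, a, z) ∉ splitPair (s - 1) (x i) (x j)) :
    ∃ σ : Fin s → ℤˣ, ∀ b i, cutStripFun (t, a, b, z) (x i) = stripFun (t, a, b * σ, z) (x i) := by
  classical
  let inS : Fin s → Fin n → Prop := fun k i =>
    ⟪x i, direction t⟫ ∈ Set.Ioc (-1 : ℝ) 1 ∧ stripIndex a ⟪x i, direction t⟫ = k
  -- The flip of a strip is the side of the cut of an arbitrarily chosen query in it; all other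
  -- queries in the strip are on the same side. Strips without queries are not flipped.
  refine ⟨fun k => if hk : ∃ i, inS k i then sgn (⟪x hk.choose, directionPerp t⟫ - z) else 1, ?_⟩
  intro b i
  unfold cutStripFun stripFun
  by_cases hi : -1 < ⟪x i, direction t⟫ ∧ ⟪x i, direction t⟫ ≤ 1
  · simp only [if_pos hi]
    have hlt : stripIndex a ⟪x i, direction t⟫ < s := by
      have := stripIndex_le a ⟪x i, direction t⟫
      omega
    simp only [stripSign, dif_pos hlt, Pi.mul_apply]
    have hk : ∃ j, inS ⟨_, hlt⟩ j := ⟨i, hi, rfl⟩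
    rw [dif_pos hk]
    congr 1
    by_contra hne
    exact h i hk.choose ⟨hi, hk.choose_spec.1, hk.choose_spec.2.symm, hne⟩
  · simp only [if_neg hi]

theorem uniformSigns_answers_eq {s n : ℕ} (hs : 1 ≤ s) (x : Fin n → E 2) {t z : ℝ}
    {a : Fin (s - 1) → ℝ} (h : ∀ i j, (t, a, z) ∉ splitPair (s - 1) (x i) (x j))
    (A : Set (Fin n → ℤˣ)) :
    uniformOn Set.univ {b : Fin s → ℤˣ | (fun i => cutStripFun (t, a, b, z) (x i)) ∈ A} =
      uniformOn Set.univ {b : Fin s → ℤˣ | (fun i => stripFun (t, a, b, z) (x i)) ∈ A} := by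
  obtain ⟨σ, hσ⟩ := exists_flip hs x h
  simp only [hσ]
  exact (measurePreserving_mul_uniformSigns σ).measure_preimage
    (s := {b | (fun i => stripFun (t, a, b, z) (x i)) ∈ A})
    (MeasurableSet.of_discrete).nullMeasurableSet

/-- Moving the signs to the last place. -/
theorem measurePreserving_signsLast (s : ℕ) :
    MeasurePreserving (fun ω : StripSeed s => ((ω.1, ω.2.1, ω.2.2.2), ω.2.2.1)) (stripLaw s)
      ((cutLaw (s - 1)).prod (uniformOn Set.univ)) := by
  rw [stripLaw_eq]
  have h1 : MeasurePreserving (fun p : (Fin (s - 1) → ℝ) × (Fin s → ℤˣ) × ℝ => ((p.1, p.2.2), p.2.1))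
      ((Measure.pi fun _ : Fin (s - 1) => unifLaw).prod
        ((uniformOn (Set.univ : Set (Fin s → ℤˣ))).prod unifLaw))
      (((Measure.pi fun _ : Fin (s - 1) => unifLaw).prod unifLaw).prod (uniformOn Set.univ)) :=
    ((measurePreserving_prodAssoc _ _ _).symm MeasurableEquiv.prodAssoc).comp
      ((MeasurePreserving.id _).prod Measure.measurePreserving_swap)
  exact ((measurePreserving_prodAssoc _ _ _).symm MeasurableEquiv.prodAssoc).comp
    ((MeasurePreserving.id _).prod h1)

theorem measurable_answers {s n : ℕ} {f : StripSeed s → E 2 → ℤˣ}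
    (hf : Measurable fun p : StripSeed s × E 2 => f p.1 p.2) (x : Fin n → E 2) :
    Measurable fun ω i => f ω (x i) := by
  refine measurable_pi_lambda _ fun i => ?_
  exact hf.of_uncurry_right

theorem stripLaw_answers_eq {s n : ℕ} {f : StripSeed s → E 2 → ℤˣ}
    (hf : Measurable fun p : StripSeed s × E 2 => f p.1 p.2) (x : Fin n → E 2)
    (A : Set (Fin n → ℤˣ)) :
    stripLaw s {ω | (fun i => f ω (x i)) ∈ A} = ∫⁻ q, uniformOn Set.univ
      {b : Fin s → ℤˣ | (fun i => f (q.1, q.2.1, b, q.2.2) (x i)) ∈ A} ∂(cutLaw (s - 1)) := by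
  have hm : MeasurableSet {p : (ℝ × (Fin (s - 1) → ℝ) × ℝ) × (Fin s → ℤˣ) |
      (fun i => f (p.1.1, p.1.2.1, p.2, p.1.2.2) (x i)) ∈ A} := by
    have h := (measurable_answers hf x).comp (by fun_prop :
      Measurable fun p : (ℝ × (Fin (s - 1) → ℝ) × ℝ) × (Fin s → ℤˣ) =>
        ((p.1.1, p.1.2.1, p.2, p.1.2.2) : StripSeed s))
    exact h (MeasurableSet.of_discrete (s := A))
  have h := (measurePreserving_signsLast s).measure_preimage hm.nullMeasurableSet
  rw [Measure.prod_apply hm] at h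
  exact h

theorem sum_splitPair_le {s n : ℕ} (hs : 1 ≤ s) (hn : (n : ℝ) ≤ (s : ℝ) ^ (1 / 10 : ℝ))
    (x : Fin n → E 2) :
    ∑ i, ∑ j, cutLaw (s - 1) (splitPair (s - 1) (x i) (x j)) ≤
      ENNReal.ofReal (6 * (s : ℝ) ^ (-(1 / 10) : ℝ)) := by
  have hs0 : (0 : ℝ) < s := by exact_mod_cast hs
  refine (Finset.sum_le_sum fun i _ => Finset.sum_le_sum fun j _ =>
    cutLaw_splitPair_le hs (x i) (x j)).trans ?_
  simp only [Finset.sum_const, Finset.card_univ, Fintype.card_fin, nsmul_eq_mul]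
  rw [← ENNReal.ofReal_natCast, ← ENNReal.ofReal_mul (by positivity),
    ← ENNReal.ofReal_mul (by positivity)]
  refine ENNReal.ofReal_le_ofReal ?_
  -- `n ^ 2` pairs at `s^(-3/10)` each: `1/10 + 1/10 - 3/10 = -1/10`.
  have e : (s : ℝ) ^ (-(1 / 10) : ℝ) =
      (s : ℝ) ^ (1 / 10 : ℝ) * ((s : ℝ) ^ (1 / 10 : ℝ) * (s : ℝ) ^ (-(3 / 10) : ℝ)) := by
    rw [← Real.rpow_add hs0, ← Real.rpow_add hs0]
    norm_num
  rw [e]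
  have h3 : 0 ≤ (s : ℝ) ^ (-(3 / 10) : ℝ) := by positivity
  calc (n : ℝ) * (n * (6 * (s : ℝ) ^ (-(3 / 10) : ℝ)))
      ≤ (s : ℝ) ^ (1 / 10 : ℝ) * ((s : ℝ) ^ (1 / 10 : ℝ) * (6 * (s : ℝ) ^ (-(3 / 10) : ℝ))) := by
        gcongr
    _ = _ := by ring

/-- Condition on the unsigned data. The conditional probabilities agree unless some pair is split,
and then the number `W` of split pairs is at least `1` and dominates the difference. -/
theorem answers_close {s n : ℕ} (hs : 1 ≤ s) (hn : (n : ℝ) ≤ (s : ℝ) ^ (1 / 10 : ℝ))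
    (x : Fin n → E 2) (A : Set (Fin n → ℤˣ)) :
    stripLaw s {ω | (fun i => stripFun ω (x i)) ∈ A} ≤
        stripLaw s {ω | (fun i => cutStripFun ω (x i)) ∈ A} +
          ENNReal.ofReal (6 * (s : ℝ) ^ (-(1 / 10) : ℝ)) ∧
      stripLaw s {ω | (fun i => cutStripFun ω (x i)) ∈ A} ≤
        stripLaw s {ω | (fun i => stripFun ω (x i)) ∈ A} +
          ENNReal.ofReal (6 * (s : ℝ) ^ (-(1 / 10) : ℝ)) := by
  set W : ℝ × (Fin (s - 1) → ℝ) × ℝ → ℝ≥0∞ := fun q =>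
    ∑ i, ∑ j, (splitPair (s - 1) (x i) (x j)).indicator 1 q with hW
  have hWm : Measurable W := Finset.measurable_sum _ fun i _ => Finset.measurable_sum _ fun j _ =>
    measurable_one.indicator (measurableSet_splitPair _ _ _)
  have hWint : ∫⁻ q, W q ∂(cutLaw (s - 1)) ≤ ENNReal.ofReal (6 * (s : ℝ) ^ (-(1 / 10) : ℝ)) := by
    refine le_trans (le_of_eq ?_) (sum_splitPair_le hs hn x)
    rw [hW, lintegral_finsetSum _ fun i _ => Finset.measurable_sum _ fun j _ =>
      measurable_one.indicator (measurableSet_splitPair _ _ _)]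
    refine Finset.sum_congr rfl fun i _ => ?_
    rw [lintegral_finsetSum _ fun j _ => measurable_one.indicator (measurableSet_splitPair _ _ _)]
    exact Finset.sum_congr rfl fun j _ => lintegral_indicator_one (measurableSet_splitPair _ _ _)
  have hW1 : ∀ q i j, q ∈ splitPair (s - 1) (x i) (x j) → 1 ≤ W q := by
    intro q i j hq
    have h1 : (1 : ℝ≥0∞) = (splitPair (s - 1) (x i) (x j)).indicator 1 q := by
      rw [Set.indicator_of_mem hq]; rfl
    rw [h1]
    exact (Finset.single_le_sum (f := fun j => (splitPair (s - 1) (x i) (x j)).indicator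
      (1 : ℝ × (Fin (s - 1) → ℝ) × ℝ → ℝ≥0∞) q) (fun _ _ => zero_le) (Finset.mem_univ j)).trans
      (Finset.single_le_sum (f := fun i => ∑ j, (splitPair (s - 1) (x i) (x j)).indicator
        (1 : ℝ × (Fin (s - 1) → ℝ) × ℝ → ℝ≥0∞) q) (fun _ _ => zero_le) (Finset.mem_univ i))
  rw [stripLaw_answers_eq (measurable_stripFun s), stripLaw_answers_eq (measurable_cutStripFun s)]
  constructor
  · refine le_trans ?_ (add_le_add_right hWint _)
    rw [← lintegral_add_right _ hWm]
    refine lintegral_mono fun q => ?_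
    by_cases h : ∃ i j, q ∈ splitPair (s - 1) (x i) (x j)
    · obtain ⟨i, j, hij⟩ := h
      exact prob_le_one.trans ((hW1 q i j hij).trans le_add_self)
    · push Not at h
      rw [uniformSigns_answers_eq hs x h]
      exact le_self_add
  · refine le_trans ?_ (add_le_add_right hWint _)
    rw [← lintegral_add_right _ hWm]
    refine lintegral_mono fun q => ?_
    by_cases h : ∃ i j, q ∈ splitPair (s - 1) (x i) (x j)
    · obtain ⟨i, j, hij⟩ := h
      exact prob_le_one.trans ((hW1 q i j hij).trans le_add_self)
    · push Not at h
      rw [uniformSigns_answers_eq hs x h]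
      exact le_self_add

theorem tvDist_answers_le {s n : ℕ} (hs : 1 ≤ s) (hn : (n : ℝ) ≤ (s : ℝ) ^ (1 / 10 : ℝ))
    (x : Fin n → E 2) :
    tvDist (stripAnswers s x) (cutStripAnswers s x) ≤ 6 * (s : ℝ) ^ (-(1 / 10) : ℝ) := by
  have : Nonempty {A : Set (Fin n → ℤˣ) // MeasurableSet A} := ⟨⟨∅, MeasurableSet.empty⟩⟩
  refine ciSup_le fun A => ?_
  unfold stripAnswers cutStripAnswers
  rw [map_measureReal_apply (measurable_answers (measurable_stripFun s) x) A.2,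
    map_measureReal_apply (measurable_answers (measurable_cutStripFun s) x) A.2]
  obtain ⟨h1, h2⟩ := answers_close hs hn x A
  have hpos : 0 ≤ 6 * (s : ℝ) ^ (-(1 / 10) : ℝ) := by positivity
  have r1 := ENNReal.toReal_mono (by finiteness) h1
  have r2 := ENNReal.toReal_mono (by finiteness) h2
  rw [ENNReal.toReal_add (by finiteness) (by finiteness), ENNReal.toReal_ofReal hpos] at r1 r2
  exact abs_le.2 ⟨by linarith! , by linarith!⟩

/-! ### The surface area of a step function of one direction -/

/-- `F` is a left-continuous step function with steps only at the points of `S`. -/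
def IsStepFun (S : Finset ℝ) (F : ℝ → ℤˣ) : Prop :=
  ∀ x y, x ≤ y → (∀ p ∈ S, x ≤ p → y ≤ p) → F x = F y

/-- At scales below `η` the steps do not interact, so the shell can be computed step by step. -/
theorem exists_gap (S : Finset ℝ) : ∃ η > 0, ∀ p ∈ S, ∀ q ∈ S, p < q → p + 2 * η < q := by
  have h : ∀ᶠ η in 𝓝[>] (0 : ℝ), ∀ p ∈ S, ∀ q ∈ S, p < q → p + 2 * η < q := by
    rw [Filter.eventually_all_finset]
    intro p _
    rw [Filter.eventually_all_finset]
    intro q _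
    by_cases hpq : p < q
    · have h1 : Tendsto (fun η : ℝ => p + 2 * η) (𝓝[>] 0) (𝓝 (p + 2 * 0)) :=
        (by fun_prop : Continuous fun η : ℝ => p + 2 * η).continuousAt.tendsto.mono_left
          nhdsWithin_le_nhds
      rw [mul_zero, add_zero] at h1
      filter_upwards [h1.eventually_lt_const hpq] with η hη _ using hη
    · exact Eventually.of_forall fun _ h => absurd h hpq
  obtain ⟨η, h1, h2⟩ := (h.and self_mem_nhdsWithin).exists
  exact ⟨η, h2, h1⟩

namespace IsStepFun

variable {S : Finset ℝ} {F : ℝ → ℤˣ} {η : ℝ}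

theorem eq_right (hF : IsStepFun S F) (hη : ∀ p ∈ S, ∀ q ∈ S, p < q → p + 2 * η < q) {p x : ℝ}
    (hp : p ∈ S) (hη0 : 0 < η) (hx : p < x) (hx2 : x < p + 2 * η) : F x = F (p + η) := by
  rcases le_total x (p + η) with h | h
  · refine hF _ _ h fun q hq hxq => ?_
    linarith [hη p hp q hq (by linarith)]
  · refine (hF _ _ h fun q hq hxq => ?_).symm
    linarith [hη p hp q hq (by linarith)]

theorem eq_left (hF : IsStepFun S F) (hη : ∀ p ∈ S, ∀ q ∈ S, p < q → p + 2 * η < q) {p x : ℝ}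
    (hp : p ∈ S) (hx : x ≤ p) (hx2 : p - 2 * η < x) : F x = F p := by
  refine hF _ _ hx fun q hq hxq => ?_
  by_contra hlt
  linarith [hη q hq p hp (not_le.1 hlt)]

/-- The steps of `F`. -/
noncomputable def jumps (S : Finset ℝ) (F : ℝ → ℤˣ) (η : ℝ) : Finset ℝ :=
  S.filter fun p => F p ≠ F (p + η)

/-- The part of the shell next to a step at `p`. -/
noncomputable def shellPiece (F : ℝ → ℤˣ) (δ p : ℝ) : Set ℝ :=
  if F p = 1 then Set.Ioc p (p + δ) else Set.Icc (p - δ) p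

/-- By left continuity the only limit points that the set can miss are the left ends of its
intervals. -/
theorem mem_closure (hF : IsStepFun S F) (hη : ∀ p ∈ S, ∀ q ∈ S, p < q → p + 2 * η < q)
    (hη0 : 0 < η) {y : ℝ} (hy : y ∈ closure {y | F y = 1}) :
    F y = 1 ∨ (y ∈ S ∧ F (y + η) = 1) := by
  have hnear : ∀ᶠ y' in 𝓝 y, y' < y + 2 * η ∧ ∀ p ∈ S.erase y, ¬ (min y y' ≤ p ∧ p ≤ max y y') := by
    refine (eventually_lt_nhds (by linarith)).and ?_
    rw [Filter.eventually_all_finset]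
    intro p hp
    rcases lt_or_gt_of_ne (Finset.ne_of_mem_erase hp) with h | h
    · filter_upwards [eventually_gt_nhds h] with y' hy' hcon
      exact absurd hcon.1 (not_le.2 (lt_min h hy'))
    · filter_upwards [eventually_lt_nhds h] with y' hy' hcon
      exact absurd hcon.2 (not_le.2 (max_lt h hy'))
  obtain ⟨y', hy', h2, h3⟩ := ((mem_closure_iff_frequently.1 hy).and_eventually hnear).exists
  rcases le_or_gt y' y with h | h
  · left
    rw [← show F y' = 1 from hy']
    refine (hF _ _ h fun p hp hyp => ?_).symm
    by_contra hlt
    rw [not_le] at hlt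
    exact h3 p (Finset.mem_erase.2 ⟨hlt.ne, hp⟩) ⟨(min_le_right _ _).trans hyp, hlt.le.trans (le_max_left _ _)⟩
  · by_cases hyS : y ∈ S
    · right
      exact ⟨hyS, by rw [← hF.eq_right hη hyS hη0 h h2]; exact hy'⟩
    · left
      rw [← show F y' = 1 from hy']
      refine hF _ _ h.le fun p hp hyp => ?_
      by_contra hlt
      rw [not_le] at hlt
      exact h3 p (Finset.mem_erase.2 ⟨fun e => hyS (e ▸ hp), hp⟩)
        ⟨(min_le_left _ _).trans hyp, hlt.le.trans (le_max_right _ _)⟩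

/-- At a step down the point `p` belongs to the set, and the shell is to its right without `p`. At a
step up the set begins just after `p`, and the shell is to the left including `p`. Other points of
`S` contribute nothing. -/
theorem shell_eq (hF : IsStepFun S F) (hη : ∀ p ∈ S, ∀ q ∈ S, p < q → p + 2 * η < q) {δ : ℝ}
    (hδ0 : 0 < δ) (hδ : δ < η) :
    Metric.cthickening δ {y | F y = 1} \ {y | F y = 1} = ⋃ p ∈ jumps S F η, shellPiece F δ p := by
  have hη0 : 0 < η := hδ0.trans hδ
  have hneg : ∀ {u : ℤˣ}, u ≠ 1 → u = -1 := fun {u} hu => (Int.units_eq_one_or u).resolve_left hu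
  ext x
  simp only [Set.mem_sdiff, Set.mem_ofPred_eq, Set.mem_iUnion, jumps, Finset.mem_filter, exists_prop]
  constructor
  · rintro ⟨hx, hFx⟩
    -- The distance to the set is attained only on its closure, which is why `mem_closure` is
    -- needed.
    rw [Metric.cthickening_eq_biUnion_closedBall _ hδ0.le] at hx
    simp only [Set.mem_iUnion, exists_prop, Metric.mem_closedBall, Real.dist_eq] at hx
    obtain ⟨y, hy, hxy⟩ := hx
    rw [abs_le] at hxy
    rcases eq_or_ne (F y) 1 with hFy | hFy
    · rcases le_total y x with h | h
      · have : ∃ p ∈ S, y ≤ p ∧ p < x := by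
          by_contra! hcon
          exact hFx ((hF y x h hcon).symm.trans hFy)
        obtain ⟨p, hp, h1, h2⟩ := this
        have e1 : F p = 1 := by rw [← hF.eq_left hη hp h1 (by linarith), hFy]
        have e2 : F (p + η) = F x := (hF.eq_right hη hp hη0 h2 (by linarith)).symm
        refine ⟨p, ⟨hp, ?_⟩, ?_⟩
        · rw [e1, e2]; exact Ne.symm hFx
        · rw [shellPiece, if_pos e1]; exact ⟨h2, by linarith⟩
      · have : ∃ p ∈ S, x ≤ p ∧ p < y := by
          by_contra! hcon
          exact hFx ((hF x y h hcon).trans hFy)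
        obtain ⟨p, hp, h1, h2⟩ := this
        have e1 : F p = F x := (hF.eq_left hη hp h1 (by linarith)).symm
        have e2 : F (p + η) = 1 := by rw [← hF.eq_right hη hp hη0 h2 (by linarith), hFy]
        refine ⟨p, ⟨hp, ?_⟩, ?_⟩
        · rw [e1, e2]; exact hFx
        · rw [shellPiece, if_neg (by rwa [e1])]; exact ⟨by linarith, h1⟩
    · obtain ⟨hyS, hy1⟩ := (hF.mem_closure hη hη0 hy).resolve_left hFy
      refine ⟨y, ⟨hyS, by rwa [hy1]⟩, ?_⟩
      rw [shellPiece, if_neg hFy]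
      refine ⟨by linarith, ?_⟩
      by_contra hlt
      exact hFx ((hF.eq_right hη hyS hη0 (not_le.1 hlt) (by linarith)).trans hy1)
  · rintro ⟨p, ⟨hp, hne⟩, hx⟩
    rw [shellPiece] at hx
    split_ifs at hx with h1
    · rw [h1] at hne
      refine ⟨?_, ?_⟩
      · refine Metric.mem_cthickening_of_dist_le x p δ _ h1 ?_
        rw [Real.dist_eq, abs_of_nonneg (by linarith [hx.1])]
        linarith [hx.2]
      · rw [hF.eq_right hη hp hη0 hx.1 (by linarith [hx.2])]
        exact hne.symm
    · have h2 : F (p + η) = 1 := by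
        by_contra h2
        rw [hneg h1, hneg h2] at hne
        exact hne rfl
      refine ⟨?_, ?_⟩
      · rw [← Metric.cthickening_closure]
        refine Metric.mem_cthickening_of_dist_le x p δ _ ?_ ?_
        · have : Set.Ioo p (p + 2 * η) ⊆ {y | F y = 1} := fun y hy => by
            rw [Set.mem_ofPred_eq, hF.eq_right hη hp hη0 hy.1 hy.2, h2]
          refine closure_mono this ?_
          rw [closure_Ioo (by linarith)]
          exact ⟨le_rfl, by linarith⟩
        · rw [Real.dist_eq, abs_of_nonpos (by linarith [hx.2])]
          linarith [hx.1]
      · rwa [hF.eq_left hη hp hx.2 (by linarith [hx.1])]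

theorem shellPiece_subset (F : ℝ → ℤˣ) {δ p : ℝ} (hδ0 : 0 < δ) (hδ : δ < η) :
    shellPiece F δ p ⊆ Set.Ioo (p - η) (p + η) := by
  intro x hx
  rw [shellPiece] at hx
  split_ifs at hx
  · exact ⟨by linarith [hx.1], by linarith [hx.2]⟩
  · exact ⟨by linarith [hx.1], by linarith [hx.2]⟩

theorem measurableSet_shellPiece (F : ℝ → ℤˣ) (δ p : ℝ) : MeasurableSet (shellPiece F δ p) := by
  rw [shellPiece]
  split_ifs
  · exact measurableSet_Ioc
  · exact measurableSet_Icc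

end IsStepFun

/-! ### Gaussian mass of the shells and the surface area on `ℝ^d` -/

theorem gaussianReal_Ioc {a b : ℝ} (hab : a ≤ b) :
    gaussianReal 0 1 (Set.Ioc a b) = ENNReal.ofReal (∫ x in a..b, gaussianPDFReal 0 1 x) := by
  rw [gaussianReal_apply_eq_integral _ one_ne_zero, intervalIntegral.integral_of_le hab]

theorem continuous_gaussianPDFReal_std : Continuous (gaussianPDFReal 0 1) := by
  unfold gaussianPDFReal
  fun_prop

theorem gaussianPDFReal_std_le (p : ℝ) : gaussianPDFReal 0 1 p ≤ 1 / 2 := by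
  unfold gaussianPDFReal
  have h1 : Real.exp (-(p - 0) ^ 2 / (2 * ((1 : NNReal) : ℝ))) ≤ 1 := by
    rw [Real.exp_le_one_iff]
    have : 0 ≤ (p - 0) ^ 2 / (2 * ((1 : NNReal) : ℝ)) := by positivity
    rw [neg_div]; linarith
  have h2 : 2 ≤ √(2 * Real.pi * ((1 : NNReal) : ℝ)) := by
    refine Real.le_sqrt_of_sq_le ?_
    norm_num
    linarith [Real.pi_gt_three]
  calc _ ≤ (√(2 * Real.pi * ((1 : NNReal) : ℝ)))⁻¹ * 1 := by gcongr
    _ ≤ 2⁻¹ * 1 := by gcongr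
    _ = 1 / 2 := by norm_num

/-- Fundamental theorem of calculus: a one-sided interval of length `δ` at `p` has mass asymptotic
to `δ` times the density at `p`, on either side. -/
theorem tendsto_shellPiece (F : ℝ → ℤˣ) (p : ℝ) :
    Tendsto (fun δ => gaussianReal 0 1 (IsStepFun.shellPiece F δ p) / ENNReal.ofReal δ) (𝓝[>] 0)
      (𝓝 (ENNReal.ofReal (gaussianPDFReal 0 1 p))) := by
  set G : ℝ → ℝ := fun x => ∫ u in (0 : ℝ)..x, gaussianPDFReal 0 1 u with hG
  have hint : ∀ a b, IntervalIntegrable (gaussianPDFReal 0 1) volume a b := fun a b =>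
    continuous_gaussianPDFReal_std.intervalIntegrable a b
  have hder : HasDerivAt G (gaussianPDFReal 0 1 p) p :=
    intervalIntegral.integral_hasDerivAt_right (hint _ _)
      (continuous_gaussianPDFReal_std.stronglyMeasurableAtFilter _ _)
      continuous_gaussianPDFReal_std.continuousAt
  have hsl := hasDerivAt_iff_tendsto_slope_zero.1 hder
  have hr : Tendsto (fun δ : ℝ => δ⁻¹ • (G (p + δ) - G p)) (𝓝[>] 0) (𝓝 (gaussianPDFReal 0 1 p)) :=
    hsl.mono_left (nhdsWithin_mono _ fun x hx => ne_of_gt hx)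
  have hl : Tendsto (fun δ : ℝ => δ⁻¹ • (G p - G (p - δ))) (𝓝[>] 0) (𝓝 (gaussianPDFReal 0 1 p)) := by
    have hneg : Tendsto (fun δ : ℝ => -δ) (𝓝[>] 0) (𝓝[≠] 0) := by
      refine tendsto_nhdsWithin_iff.2 ⟨?_, ?_⟩
      · have := (continuous_neg (G := ℝ)).tendsto 0
        rw [neg_zero] at this
        exact this.mono_left nhdsWithin_le_nhds
      · filter_upwards [self_mem_nhdsWithin] with δ hδ
        simpa using (ne_of_gt hδ)
    refine (hsl.comp hneg).congr fun δ => ?_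
    simp only [Function.comp_apply, smul_eq_mul, ← sub_eq_add_neg, inv_neg]
    ring
  by_cases h : F p = 1
  · refine (ENNReal.tendsto_ofReal hr).congr' ?_
    filter_upwards [self_mem_nhdsWithin] with δ hδ
    have hδ' : 0 < δ := hδ
    rw [IsStepFun.shellPiece, if_pos h, gaussianReal_Ioc (by linarith), ← ENNReal.ofReal_div_of_pos hδ',
      hG]
    simp only
    rw [intervalIntegral.integral_interval_sub_left (hint _ _) (hint _ _), smul_eq_mul, inv_mul_eq_div]
  · refine (ENNReal.tendsto_ofReal hl).congr' ?_
    filter_upwards [self_mem_nhdsWithin] with δ hδ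
    have hδ' : 0 < δ := hδ
    have := nullSingletonClass_gaussianReal (μ := 0) one_ne_zero
    rw [IsStepFun.shellPiece, if_neg h, ← measure_congr Ioc_ae_eq_Icc, gaussianReal_Ioc (by linarith),
      ← ENNReal.ofReal_div_of_pos hδ', hG]
    simp only
    rw [intervalIntegral.integral_interval_sub_left (hint _ _) (hint _ _), smul_eq_mul, inv_mul_eq_div]

/-- The projection to a unit vector does not increase distances, and moving along `u` reaches any
prescribed value at the least cost. Hence shells in `ℝ^d` are preimages of shells in `ℝ`. -/
theorem infEDist_preimage_inner {d : ℕ} {u : E d} (hu : ‖u‖ = 1) (B : Set ℝ) (x : E d) :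
    Metric.infEDist x ((fun y => (⟪u, y⟫ : ℝ)) ⁻¹' B) = Metric.infEDist (⟪u, x⟫ : ℝ) B := by
  refine le_antisymm ?_ ?_
  · refine Metric.le_infEDist.2 fun y hy => ?_
    refine (Metric.infEDist_le_edist_of_mem
      (y := x + (y - ⟪u, x⟫) • u) ?_).trans (le_of_eq ?_)
    · simp only [Set.mem_preimage, inner_add_right, inner_smul_right, real_inner_self_eq_norm_sq, hu]
      convert hy using 1
      ring
    · rw [edist_dist, edist_dist, dist_eq_norm, Real.dist_eq, ← sub_sub, sub_self, zero_sub, norm_neg,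
        norm_smul, hu, mul_one, Real.norm_eq_abs, abs_sub_comm]
  · refine Metric.le_infEDist.2 fun y hy => (Metric.infEDist_le_edist_of_mem
      (show (⟪u, y⟫ : ℝ) ∈ B from hy)).trans ?_
    rw [edist_dist, edist_dist, Real.dist_eq, dist_eq_norm x y, ← inner_sub_right]
    refine ENNReal.ofReal_le_ofReal ((abs_real_inner_le_norm _ _).trans (by rw [hu, one_mul]))

/-- The limit exists and equals the sum of the densities at the jumps. Each density is at most `1 /
√(2π) < 1/2`. -/
theorem IsStepFun.hasSurfaceAreaAtMost {d : ℕ} {S : Finset ℝ} {F : ℝ → ℤˣ} (hF : IsStepFun S F)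
    (hFm : Measurable F) {u : E d} (hu : ‖u‖ = 1) {r : ℝ} (hr : (S.card : ℝ) / 2 ≤ r) :
    HasSurfaceAreaAtMost (fun x : E d => F ⟪u, x⟫) r := by
  obtain ⟨η, hη0, hη⟩ := exists_gap S
  set L : ℝ≥0∞ := ∑ p ∈ IsStepFun.jumps S F η, ENNReal.ofReal (gaussianPDFReal 0 1 p) with hL
  have hBm : MeasurableSet {y | F y = 1} := measurableSet_eq_fun hFm measurable_const
  have hlim : Tendsto (shellRatio {x : E d | F ⟪u, x⟫ = 1}) (𝓝[>] 0) (𝓝 L) := by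
    have hsum := tendsto_finsetSum (IsStepFun.jumps S F η)
      fun p (_ : p ∈ IsStepFun.jumps S F η) => tendsto_shellPiece F p
    refine hsum.congr' ?_
    filter_upwards [Ioo_mem_nhdsGT hη0] with δ hδ
    have hpre : Metric.cthickening δ {x : E d | F ⟪u, x⟫ = 1} \ {x : E d | F ⟪u, x⟫ = 1} =
        (fun x : E d => (⟪u, x⟫ : ℝ)) ⁻¹'
          (Metric.cthickening δ {y | F y = 1} \ {y | F y = 1}) := by
      ext x
      simp only [Set.mem_sdiff, Set.mem_preimage, Metric.mem_cthickening_iff]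
      rw [← infEDist_preimage_inner hu]
      rfl
    have hmeas : MeasurableSet (Metric.cthickening δ {y | F y = 1} \ {y | F y = 1}) :=
      Metric.isClosed_cthickening.measurableSet.diff hBm
    have hin : Measurable fun x : E d => (⟪u, x⟫ : ℝ) := by fun_prop
    unfold shellRatio gauss
    rw [hpre, ← Measure.map_apply hin hmeas, map_inner_stdGaussian u hu,
      hF.shell_eq hη hδ.1 hδ.2, measure_biUnion_finset]
    · simp only [ENNReal.div_eq_inv_mul, Finset.mul_sum]
    · intro p hp q hq hpq
      have hp' := (Finset.mem_filter.1 hp).1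
      have hq' := (Finset.mem_filter.1 hq).1
      refine Set.disjoint_left.2 fun x hx hx' => ?_
      have h1 := IsStepFun.shellPiece_subset F hδ.1 hδ.2 hx
      have h2 := IsStepFun.shellPiece_subset F hδ.1 hδ.2 hx'
      rcases lt_or_gt_of_ne hpq with h | h
      · linarith [hη p hp' q hq' h, h1.2, h2.1]
      · linarith [hη q hq' p hp' h, h2.2, h1.1]
    · exact fun p _ => IsStepFun.measurableSet_shellPiece F δ p
  have harea : surfaceArea {x : E d | F ⟪u, x⟫ = 1} = L := hlim.liminf_eq
  refine ⟨by rw [harea]; exact hlim, ?_⟩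
  rw [harea, hL, ← ENNReal.ofReal_sum_of_nonneg fun p _ => gaussianPDFReal_nonneg 0 1 p]
  refine ENNReal.ofReal_le_ofReal (le_trans ?_ hr)
  refine (Finset.sum_le_sum fun p _ => gaussianPDFReal_std_le p).trans ?_
  rw [Finset.sum_const, nsmul_eq_mul]
  have : ((IsStepFun.jumps S F η).card : ℝ) ≤ S.card := by
    exact_mod_cast Finset.card_filter_le _ _
  linarith

/-- The profile of a strip function. -/
noncomputable def stripProfile {s : ℕ} (ω : StripSeed s) (y : ℝ) : ℤˣ :=
  if -1 < y ∧ y ≤ 1 then stripVal ω.2.1 ω.2.2.1 y else 1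

theorem isStepFun_stripProfile {s : ℕ} (ω : StripSeed s) :
    IsStepFun (insert (-1) (insert 1 (Finset.univ.image ω.2.1))) (stripProfile ω) := by
  intro x y hxy h
  have h1 := h (-1) (by simp)
  have h2 := h 1 (by simp)
  have h3 : ∀ j, x ≤ ω.2.1 j → y ≤ ω.2.1 j := fun j => h _ (by simp)
  have hidx : stripIndex ω.2.1 x = stripIndex ω.2.1 y := by
    unfold stripIndex
    congr 1
    refine Finset.filter_congr fun j _ => ⟨fun hj => hj.trans_le hxy, fun hj => ?_⟩
    by_contra hcon
    exact absurd (h3 j (not_lt.1 hcon)) (not_le.2 hj)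
  have hiff : (-1 < x ∧ x ≤ 1) ↔ (-1 < y ∧ y ≤ 1) := by
    refine ⟨fun hx => ⟨hx.1.trans_le hxy, h2 hx.2⟩, fun hy => ⟨?_, hxy.trans hy.2⟩⟩
    by_contra hcon
    exact absurd (h1 (not_lt.1 hcon)) (not_le.2 hy.1)
  unfold stripProfile stripVal
  simp only [hiff, hidx]

theorem measurable_stripProfile {s : ℕ} (ω : StripSeed s) : Measurable (stripProfile ω) :=
  Measurable.ite measurableSet_Ioc (measurable_stripVal_right _ _) measurable_const

theorem stripFun_comp_planeProj {d : ℕ} (ι : E 2 →ₗᵢ[ℝ] E d) {s : ℕ} (ω : StripSeed s) (x : E d) :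
    stripFun ω (planeProj ι x) = stripProfile ω ⟪ι (direction ω.1), x⟫ := by
  rw [real_inner_comm, ← inner_planeProj]
  rfl

theorem hasSurfaceAreaAtMost_stripFun {d : ℕ} (ι : E 2 →ₗᵢ[ℝ] E d) {s : ℕ} (hs : 1 ≤ s)
    (ω : StripSeed s) : HasSurfaceAreaAtMost (fun x => stripFun ω (planeProj ι x)) s := by
  simp only [stripFun_comp_planeProj]
  refine (isStepFun_stripProfile ω).hasSurfaceAreaAtMost (measurable_stripProfile ω)
    (by rw [ι.norm_map, norm_direction]) ?_
  have h1 := Finset.card_insert_le (-1 : ℝ) (insert 1 (Finset.univ.image ω.2.1))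
  have h2 := Finset.card_insert_le (1 : ℝ) (Finset.univ.image ω.2.1)
  have h3 : (Finset.univ.image ω.2.1).card ≤ s - 1 := Finset.card_image_le.trans (by simp)
  -- The `s - 1` cuts and the two ends make at most `s + 1 ≤ 2 * s` steps; this is where `s ≥ 1`
  -- enters.
  have h4 : (insert (-1 : ℝ) (insert 1 (Finset.univ.image ω.2.1))).card ≤ 2 * s := by omega
  have h5 : ((insert (-1 : ℝ) (insert 1 (Finset.univ.image ω.2.1))).card : ℝ) ≤ 2 * s := by
    exact_mod_cast h4
  linarith

theorem isLinearJunta_stripFun {d : ℕ} (ι : E 2 →ₗᵢ[ℝ] E d) {s : ℕ} (ω : StripSeed s) :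
    IsLinearJunta 1 fun x => stripFun ω (planeProj ι x) :=
  ⟨fun _ => ι (direction ω.1), fun v => stripProfile ω (v 0),
    fun _ => by rw [ι.norm_map, norm_direction], fun x => stripFun_comp_planeProj ι ω x⟩

/-! ### The lower bound for testers -/

theorem exists_linearIsometry_plane {d : ℕ} (hd : 2 ≤ d) : Nonempty (E 2 →ₗᵢ[ℝ] E d) := by
  have hv : Orthonormal ℝ (EuclideanSpace.basisFun (Fin d) ℝ ∘ Fin.castLE hd) :=
    (EuclideanSpace.basisFun (Fin d) ℝ).orthonormal.comp _ (Fin.castLE_injective hd)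
  set b := (EuclideanSpace.basisFun (Fin 2) ℝ).toBasis with hb
  refine ⟨(b.constr ℝ (EuclideanSpace.basisFun (Fin d) ℝ ∘ Fin.castLE hd)).isometryOfOrthonormal
    (v := b) ?_ ?_⟩
  · rw [hb, OrthonormalBasis.coe_toBasis]
    exact (EuclideanSpace.basisFun (Fin 2) ℝ).orthonormal
  · convert hv using 1
    ext1 i
    simp

theorem IsFarFromLinearJuntas_mono {d k : ℕ} {ε ε' : ℝ} (h : ε ≤ ε') {f : E d → ℤˣ}
    (hf : IsFarFromLinearJuntas k ε' f) : IsFarFromLinearJuntas k ε f :=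
  fun g hg hg' => h.trans (hf g hg hg')

section Tester

variable {d q : ℕ} (T : NonadaptiveTester d q)

theorem measurableSet_accepts {f : E d → ℤˣ} (hf : Measurable f) :
    MeasurableSet {r | (r, fun i => f (T.query r i)) ∈ T.accept} := by
  have hq := T.measurable_query
  have : Measurable fun r => (r, fun i => f (T.query r i)) :=
    measurable_id.prodMk (measurable_pi_lambda _ fun i =>
      hf.comp ((measurable_pi_apply i).comp hq))
  exact this T.measurableSet_accept

theorem acceptProb_add_rejectProb {f : E d → ℤˣ} (hf : Measurable f) :
    T.acceptProb f + T.rejectProb f = 1 :=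
  probReal_add_probReal_compl (measurableSet_accepts T hf)

/-- Averaging over the random strip functions (Yao's principle). -/
theorem yao_strips (ι : E 2 →ₗᵢ[ℝ] E d) {s c : ℝ} (hT : T.Distinguishes s c) (hc : c ≤ sepConst)
    {k : ℕ} (hk : 1 ≤ k) (hks : (k : ℝ) ≤ s) (hq : (q : ℝ) ≤ (k : ℝ) ^ (1 / 10 : ℝ)) :
    (k : ℝ) ^ (1 / 10 : ℝ) ≤ 78 := by
  have hk0 : (0 : ℝ) < k := by exact_mod_cast hk
  have hk1 : (1 : ℝ) ≤ k := by exact_mod_cast hk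
  have hpm := (planeProj ι).measurable
  have hqm := T.measurable_query
  have hmeas : ∀ {f : StripSeed k → E 2 → ℤˣ},
      (Measurable fun p : StripSeed k × E 2 => f p.1 p.2) →
        MeasurableSet {p : T.Seed × StripSeed k |
          (p.1, fun i => f p.2 (planeProj ι (T.query p.1 i))) ∈ T.accept} := by
    intro f hf
    have : Measurable fun p : T.Seed × StripSeed k =>
        (p.1, fun i => f p.2 (planeProj ι (T.query p.1 i))) := by
      refine measurable_fst.prodMk (measurable_pi_lambda _ fun i => ?_)
      exact hf.comp (measurable_snd.prodMk
        (hpm.comp ((measurable_pi_apply i).comp (hqm.comp measurable_fst))))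
    exact this T.measurableSet_accept
  have hSf := hmeas (measurable_stripFun k)
  have hSg := hmeas (measurable_cutStripFun k)
  set Sf := {p : T.Seed × StripSeed k |
    (p.1, fun i => stripFun p.2 (planeProj ι (T.query p.1 i))) ∈ T.accept}
  set Sg := {p : T.Seed × StripSeed k |
    (p.1, fun i => cutStripFun p.2 (planeProj ι (T.query p.1 i))) ∈ T.accept}
  set ε : ℝ := 6 * (k : ℝ) ^ (-(1 / 10) : ℝ)
  set β : ℝ := 20 * (k : ℝ) ^ (-(1 / 2) : ℝ)
  have hε : 0 ≤ ε := by positivity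
  have hβ : 0 ≤ β := by positivity
  have h1 : ENNReal.ofReal (2 / 3) ≤ (T.law.prod (stripLaw k)) Sf := by
    rw [Measure.prod_apply_symm hSf]
    calc ENNReal.ofReal (2 / 3) = ∫⁻ _, ENNReal.ofReal (2 / 3) ∂(stripLaw k) := by simp
      _ ≤ _ := by
        refine lintegral_mono fun ω => ?_
        refine (ENNReal.ofReal_le_iff_le_toReal (measure_ne_top _ _)).2 ?_
        refine hT.1 (fun x => stripFun ω (planeProj ι x)) ((measurable_stripFun_right ω).comp hpm)
          (isLinearJunta_stripFun ι ω) ?_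
        obtain ⟨ha, hb⟩ := hasSurfaceAreaAtMost_stripFun ι hk ω
        exact ⟨ha, hb.trans (ENNReal.ofReal_le_ofReal hks)⟩
  -- For a fixed tester seed the queries are fixed and acceptance is an event in the answers:
  -- non-adaptivity is used here.
  have h2 : (T.law.prod (stripLaw k)) Sf ≤
      (T.law.prod (stripLaw k)) Sg + ENNReal.ofReal ε := by
    rw [Measure.prod_apply hSf, Measure.prod_apply hSg]
    calc _ ≤ ∫⁻ r, ((stripLaw k) (Prod.mk r ⁻¹' Sg) + ENNReal.ofReal ε) ∂T.law :=
          lintegral_mono fun r =>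
            (answers_close hk hq (fun i => planeProj ι (T.query r i)) {v | (r, v) ∈ T.accept}).1
      _ = _ := by rw [lintegral_add_right _ measurable_const]; simp
  have h3 : (T.law.prod (stripLaw k)) Sg ≤ ENNReal.ofReal (1 / 3) + ENNReal.ofReal β := by
    rw [Measure.prod_apply_symm hSg]
    -- A measurable hull of the bad seeds has the same measure and avoids proving them measurable.
    set Bd := toMeasurable (stripLaw k) (badSeeds k) with hBd
    have hBm : MeasurableSet Bd := measurableSet_toMeasurable _ _
    calc _ ≤ ∫⁻ ω, (ENNReal.ofReal (1 / 3) + Bd.indicator 1 ω) ∂(stripLaw k) := by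
          refine lintegral_mono fun ω => ?_
          by_cases hω : ω ∈ Bd
          · rw [Set.indicator_of_mem hω]
            exact prob_le_one.trans le_add_self
          · refine le_trans ?_ le_self_add
            have hfm := (measurable_cutStripFun_right ω).comp hpm
            have hfar := IsFarFromLinearJuntas_mono hc
              (far_of_notMem_badSeeds ι fun h => hω (subset_toMeasurable _ _ h))
            have hrej := hT.2 _ hfm hfar
            have hacc := acceptProb_add_rejectProb T hfm
            refine (ENNReal.le_ofReal_iff_toReal_le (measure_ne_top _ _) (by norm_num)).2 ?_
            have : T.acceptProb (fun x => cutStripFun ω (planeProj ι x)) ≤ 1 / 3 := by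
              change T.acceptProb (fun x => cutStripFun ω (planeProj ι x)) + _ = 1 at hacc
              change _ ≤ T.rejectProb (fun x => cutStripFun ω (planeProj ι x)) at hrej
              change _ + T.rejectProb (fun x => cutStripFun ω (planeProj ι x)) = 1 at hacc
              linarith
            exact this
      _ = ENNReal.ofReal (1 / 3) + stripLaw k (badSeeds k) := by
          rw [lintegral_add_left measurable_const, lintegral_indicator_one hBm, hBd,
            measure_toMeasurable]
          simp
      _ ≤ _ := by gcongr; exact stripLaw_badSeeds_le hk
  have h4 := h1.trans (h2.trans (add_le_add_left h3 _))
  rw [← ENNReal.ofReal_add (by norm_num) hβ, ← ENNReal.ofReal_add (by positivity) hε,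
    ENNReal.ofReal_le_ofReal_iff (by positivity)] at h4
  -- With both error terms in the same power, `2/3 ≤ 1/3 + (20 + 6) * k^(-1/10)`, whence `78 = 3 *
  -- 26`.
  have h5 : (k : ℝ) ^ (-(1 / 2) : ℝ) ≤ (k : ℝ) ^ (-(1 / 10) : ℝ) :=
    Real.rpow_le_rpow_of_exponent_le hk1 (by norm_num)
  have h6 : 1 / 78 ≤ (k : ℝ) ^ (-(1 / 10) : ℝ) := by linarith
  rw [Real.rpow_neg hk0.le, one_div] at h6
  exact (inv_le_inv₀ (by norm_num) (by positivity)).1 h6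

end Tester

/-! ### Functions that are `-1` on a small disc -/

/-- The function that is `-1` on the disc around `p` with radius `ρ`, and `1` elsewhere. -/
noncomputable def discFun (p : E 2) (ρ : ℝ) (x : E 2) : ℤˣ :=
  open Classical in if x ∈ Metric.ball p ρ then -1 else 1

theorem measurable_discFun (p : E 2) (ρ : ℝ) : Measurable (discFun p ρ) := by
  classical
  exact Measurable.ite Metric.isOpen_ball.measurableSet measurable_const measurable_const

theorem norm_sq_rotated (t a b : ℝ) : ‖a • directionPerp t + b • direction t‖ ^ 2 = a ^ 2 + b ^ 2 := by
  rw [EuclideanSpace.norm_sq_eq]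
  simp [Fin.sum_univ_two]
  linear_combination (a ^ 2 + b ^ 2) * Real.sin_sq_add_cos_sq t

theorem mem_ball_rotated (p : E 2) {ρ : ℝ} (hρ : 0 < ρ) (t m n : ℝ) :
    m • directionPerp t + n • direction t ∈ Metric.ball p ρ ↔
      (m - ⟪directionPerp t, p⟫) ^ 2 + (n - ⟪direction t, p⟫) ^ 2 < ρ ^ 2 := by
  rw [← norm_sq_rotated t, mem_ball_iff_norm, ← sq_lt_sq₀ (norm_nonneg _) hρ.le]
  nth_rewrite 1 [eq_inner_smul_add t p]
  rw [sub_smul, sub_smul, add_sub_add_comm]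

/-- A box of side `ρ`: `m` and `n` within `ρ / 2` of the centre give a point inside the disc, and
`n'` at least `ρ` away gives one outside. -/
theorem volume_splitSet_discFun {p : E 2} (hp : ‖p‖ ≤ 2) {ρ : ℝ} (hρ : 0 < ρ) (hρ1 : ρ ≤ 1) (t : ℝ) :
    ENNReal.ofReal (ρ ^ 3) ≤ volume (splitSet (discFun p ρ) t ∩ cube 8) := by
  set m₀ : ℝ := ⟪directionPerp t, p⟫ with hm₀
  set n₀ : ℝ := ⟪direction t, p⟫ with hn₀
  have hm₀b : |m₀| ≤ 2 := by
    have := abs_real_inner_le_norm (directionPerp t) p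
    rw [norm_directionPerp] at this
    linarith
  have hn₀b : |n₀| ≤ 2 := by
    have := abs_real_inner_le_norm (direction t) p
    rw [norm_direction] at this
    linarith
  rw [abs_le] at hm₀b hn₀b
  have hvol : volume (Set.Icc (m₀ - ρ / 2) (m₀ + ρ / 2) ×ˢ Set.Icc (n₀ - ρ / 2) (n₀ + ρ / 2) ×ˢ
      Set.Icc (n₀ + ρ) (n₀ + 2 * ρ)) = ENNReal.ofReal (ρ ^ 3) := by
    rw [Measure.volume_eq_prod, Measure.prod_prod, Measure.volume_eq_prod, Measure.prod_prod,
      Real.volume_Icc, Real.volume_Icc, Real.volume_Icc, ← ENNReal.ofReal_mul, ← ENNReal.ofReal_mul]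
    · congr 1; ring
    · linarith
    · linarith
  rw [← hvol]
  refine measure_mono ?_
  rintro ⟨m, n, n'⟩ ⟨⟨hm1, hm2⟩, ⟨hn1, hn2⟩, hn1', hn2'⟩
  simp only at hm1 hm2 hn1 hn2 hn1' hn2'
  refine ⟨?_, mem_cube (abs_le.2 ⟨by linarith, by linarith⟩) (abs_le.2 ⟨by linarith, by linarith⟩)
    (abs_le.2 ⟨by linarith, by linarith⟩)⟩
  show discFun p ρ _ ≠ discFun p ρ _
  have h1 : m • directionPerp t + n • direction t ∈ Metric.ball p ρ := by
    rw [mem_ball_rotated p hρ, ← hm₀, ← hn₀]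
    have a : (m - m₀) ^ 2 ≤ (ρ / 2) ^ 2 := sq_le_sq' (by linarith) (by linarith)
    have b : (n - n₀) ^ 2 ≤ (ρ / 2) ^ 2 := sq_le_sq' (by linarith) (by linarith)
    have : 0 < ρ ^ 2 := by positivity
    linarith [div_pow ρ 2 2]
  have h2 : m • directionPerp t + n' • direction t ∉ Metric.ball p ρ := by
    rw [mem_ball_rotated p hρ, ← hm₀, ← hn₀, not_lt]
    have b : ρ ^ 2 ≤ (n' - n₀) ^ 2 := pow_le_pow_left₀ hρ.le (by linarith) 2
    linarith [sq_nonneg (m - m₀)]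
  rw [discFun, discFun, if_pos h1, if_neg h2]
  decide

theorem isFar_discFun_comp {d : ℕ} (ι : E 2 →ₗᵢ[ℝ] E d) {p : E 2} (hp : ‖p‖ ≤ 2) {ρ : ℝ} (hρ : 0 < ρ)
    (hρ1 : ρ ≤ 1) : IsFarFromLinearJuntas 1 (gaussianPDFReal 0 1 8 ^ 3 * ρ ^ 3 / 2)
      fun x => discFun p ρ (planeProj ι x) := by
  refine isFarFromLinearJuntas_comp_planeProj ι (measurable_discFun p ρ) fun t => ?_
  have := gaussTriple_real_ge (volume_splitSet_discFun hp hρ hρ1 t)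
  linarith

theorem isStepFun_const (b : ℤˣ) : IsStepFun ∅ fun _ => b := fun _ _ _ _ => rfl

/-! ### Excluding boundedly many queries, and the bound for all `s` -/

section Tester

variable {d q : ℕ} (T : NonadaptiveTester d q)

/-- A tester with few queries misses some disc out of many disjoint ones. -/
theorem card_discs_le (ι : E 2 →ₗᵢ[ℝ] E d) {s c : ℝ} (hs : 0 ≤ s) (hT : T.Distinguishes s c) {N : ℕ}
    (hN : 1 ≤ N) (hc : c ≤ gaussianPDFReal 0 1 8 ^ 3 * (1 / N : ℝ) ^ 3 / 2) : N ≤ 3 * q := by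
  have hN0 : (0 : ℝ) < N := by exact_mod_cast hN
  set ρ : ℝ := 1 / N with hρ
  have hρ0 : 0 < ρ := by positivity
  have hρ1 : ρ ≤ 1 := by
    rw [hρ, div_le_one hN0]; exact_mod_cast hN
  have hNρ : N * ρ = 1 := by rw [hρ]; field_simp
  -- Centres on a line at spacing `2 * ρ`: the open discs are disjoint, and all centres have norm at
  -- most `2 * ρ * N = 2`.
  let p : Fin N → E 2 := fun j => (2 * ρ * j) • direction 0
  have hpn : ∀ j, ‖p j‖ ≤ 2 := by
    intro j
    have hj : (j : ℝ) ≤ N := by exact_mod_cast j.2.le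
    rw [norm_smul, norm_direction, mul_one, Real.norm_of_nonneg (by positivity)]
    have := mul_le_mul_of_nonneg_right hj hρ0.le
    linarith
  have hdisj : Pairwise fun j j' => Disjoint (Metric.ball (p j) ρ) (Metric.ball (p j') ρ) := by
    intro j j' hne
    refine Metric.ball_disjoint_ball ?_
    rw [dist_eq_norm, ← sub_smul, norm_smul, norm_direction, mul_one, Real.norm_eq_abs, ← mul_sub,
      abs_mul, abs_of_pos (by positivity)]
    have hint : (1 : ℤ) ≤ |((j : ℕ) : ℤ) - ((j' : ℕ) : ℤ)| :=
      Int.one_le_abs (sub_ne_zero.2 fun h => hne (Fin.ext (by exact_mod_cast h)))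
    have : (1 : ℝ) ≤ |((j : ℕ) : ℝ) - ((j' : ℕ) : ℝ)| := by exact_mod_cast hint
    nlinarith
  have hpm := (planeProj ι).measurable
  have hone : 2 / 3 ≤ T.acceptProb fun _ => 1 := by
    refine hT.1 _ measurable_const ⟨fun _ => ι (direction 0), fun _ => 1,
      fun _ => by rw [ι.norm_map, norm_direction], fun _ => rfl⟩ ?_
    exact (isStepFun_const 1).hasSurfaceAreaAtMost measurable_const
      (u := ι (direction 0)) (by rw [ι.norm_map, norm_direction]) (by simpa using hs)
  have honer : T.rejectProb (fun _ => 1) ≤ 1 / 3 := by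
    linarith [acceptProb_add_rejectProb T (measurable_const (a := (1 : ℤˣ)))]
  let H : Fin q → Fin N → Set T.Seed := fun i j =>
    {r | planeProj ι (T.query r i) ∈ Metric.ball (p j) ρ}
  have hHm : ∀ i j, MeasurableSet (H i j) := fun i j =>
    (hpm.comp ((measurable_pi_apply i).comp T.measurable_query)) Metric.isOpen_ball.measurableSet
  -- The tester rejects the constant `1` with probability at most `1/3` and the disc function with
  -- probability at least `2/3`; the answers coincide unless a query hits the disc.
  have hhit : ∀ j, 1 / 3 ≤ ∑ i, T.law.real (H i j) := by
    intro j
    have hrej := hT.2 _ ((measurable_discFun (p j) ρ).comp hpm)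
      (IsFarFromLinearJuntas_mono hc (isFar_discFun_comp ι (hpn j) hρ0 hρ1))
    have hsub : {r | (r, fun i => discFun (p j) ρ (planeProj ι (T.query r i))) ∉ T.accept} ⊆
        {r | (r, fun _ => 1) ∉ T.accept} ∪ ⋃ i, H i j := by
      intro r hr
      by_cases hh : ∃ i, r ∈ H i j
      · exact Or.inr (Set.mem_iUnion.2 hh)
      · push Not at hh
        left
        have : (fun i => discFun (p j) ρ (planeProj ι (T.query r i))) = fun _ => 1 := by
          ext1 i
          exact if_neg (hh i)
        intro hcon
        refine hr ?_
        rw [Set.mem_ofPred_eq] at *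
        rwa [this]
    have h1 : T.rejectProb (fun x => discFun (p j) ρ (planeProj ι x)) ≤
        T.rejectProb (fun _ => 1) + ∑ i, T.law.real (H i j) :=
      (measureReal_mono hsub).trans ((measureReal_union_le _ _).trans
        (add_le_add_right (measureReal_iUnion_fintype_le _) _))
    change 2 / 3 ≤ T.rejectProb (fun x => discFun (p j) ρ (planeProj ι x)) at hrej
    linarith
  -- A single query lies in at most one disc. Double counting then gives `N / 3 ≤ q`.
  have hrow : ∀ i, ∑ j, T.law.real (H i j) ≤ 1 := by
    intro i
    rw [← measureReal_iUnion_fintype (fun j j' hne => ?_) (hHm i)]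
    · exact measureReal_le_one
    · exact Set.disjoint_left.2 fun r hr hr' => Set.disjoint_left.1 (hdisj hne) hr hr'
  have h1 : (N : ℝ) * (1 / 3) ≤ ∑ j, ∑ i, T.law.real (H i j) := by
    refine le_trans (le_of_eq ?_) (Finset.sum_le_sum fun j _ => hhit j)
    simp
  rw [Finset.sum_comm] at h1
  have h2 : ∑ i, ∑ j, T.law.real (H i j) ≤ q := by
    refine (Finset.sum_le_sum fun i _ => hrow i).trans (le_of_eq ?_)
    simp
  have h3 : (N : ℝ) ≤ 3 * q := by linarith
  exact_mod_cast h3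

/-- The separation constant of the lower bound for testers. -/
noncomputable def testerConst : ℝ := min sepConst (gaussianPDFReal 0 1 8 ^ 3 * (1 / 235 : ℝ) ^ 3 / 2)

theorem testerConst_pos : 0 < testerConst := by
  have := gaussianPDFReal_pos 0 1 8 one_ne_zero
  exact lt_min sepConst_pos (by positivity)

/-- The disc bound gives `q ≥ 79` for every `s`. If also `q < s^(1/10)`, then Yao's principle with
`⌊s⌋` strips gives `q ≤ 78`. -/
theorem tester_lower_bound (hd : 2 ≤ d) {s : ℝ} (hs : 0 < s) (hT : T.Distinguishes s testerConst) :
    s ^ (1 / 10 : ℝ) ≤ q := by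
  obtain ⟨ι⟩ := exists_linearIsometry_plane hd
  by_contra! hlt
  -- `235 = 3 * 78 + 1` is the least number of discs that rules out `q = 78`.
  have h235 : 235 ≤ 3 * q := card_discs_le T ι hs.le hT (N := 235) (by norm_num) (min_le_right _ _)
  have h79 : (79 : ℝ) ≤ q := by
    have : 79 ≤ q := by omega
    exact_mod_cast this
  have hpow : (q : ℝ) ^ 10 < s := by
    have := pow_lt_pow_left₀ hlt (Nat.cast_nonneg q) (by norm_num : 10 ≠ 0)
    rwa [← Real.rpow_natCast (s ^ (1 / 10 : ℝ)), ← Real.rpow_mul hs.le, show (1 / 10 : ℝ) * ((10 : ℕ) : ℝ) = 1 by norm_num,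
      Real.rpow_one] at this
  set k := ⌊s⌋₊ with hk
  -- Since `q ^ 10` is an integer, rounding `s` down costs nothing.
  have hqk : q ^ 10 ≤ k := Nat.le_floor (by push_cast; exact hpow.le)
  have hk1 : 1 ≤ k := by
    have : 0 < q ^ 10 := by
      have : 0 < q := by omega
      positivity
    omega
  have hqk' : (q : ℝ) ≤ (k : ℝ) ^ (1 / 10 : ℝ) := by
    have : ((q : ℝ) ^ 10) ^ (1 / 10 : ℝ) ≤ (k : ℝ) ^ (1 / 10 : ℝ) :=
      Real.rpow_le_rpow (by positivity) (by exact_mod_cast hqk) (by norm_num)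
    rwa [← Real.rpow_natCast, ← Real.rpow_mul (Nat.cast_nonneg q),
      show ((10 : ℕ) : ℝ) * (1 / 10 : ℝ) = 1 by norm_num, Real.rpow_one] at this
  have := yao_strips T ι hT (min_le_left _ _) hk1 (Nat.floor_le hs.le) hqk'
  linarith

end Tester

theorem theorem5p1 :
    -- the lower bound for non-adaptive testers, in every dimension `d ≥ 2`
    (∃ c : ℝ, 0 < c ∧ ∀ d : ℕ, 2 ≤ d → ∀ s : ℝ, 0 < s → ∀ (q : ℕ) (T : NonadaptiveTester d q),
      T.Distinguishes s c → s ^ (1 / 10 : ℝ) ≤ q) ∧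
    -- closeness of the two query distributions
    (∃ C : ℝ, 0 < C ∧ ∀ s : ℕ, 1 ≤ s → ∀ n : ℕ, (n : ℝ) ≤ (s : ℝ) ^ (1 / 10 : ℝ) →
      ∀ x : Fin n → E 2,
        tvDist (stripAnswers s x) (cutStripAnswers s x) ≤ C * (s : ℝ) ^ (-(1 / 10) : ℝ)) ∧
    -- the cut functions are far from linear 1-juntas, except with polynomially small probability
    (∃ c : ℝ, 0 < c ∧ ∃ C : ℝ, 0 < C ∧ ∃ α : ℝ, 0 < α ∧ ∀ s : ℕ, 1 ≤ s →
      stripLaw s {ω | ¬ IsFarFromLinearJuntas 1 c (cutStripFun ω)} ≤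
        ENNReal.ofReal (C * (s : ℝ) ^ (-α))) :=
  ⟨⟨testerConst, testerConst_pos, fun _ hd _ hs _ T hT => tester_lower_bound T hd hs hT⟩,
    ⟨6, by norm_num, fun _ hs _ hn x => tvDist_answers_le hs hn x⟩,
    ⟨sepConst, sepConst_pos, 20, by norm_num, 1 / 2, by norm_num,
      fun _ hs => cutStripFun_far_with_high_probability hs⟩⟩
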